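/- Let $E=(E^0,E^1,r,s)$ be a finite directed graph (loops, parallel edges, sinks and sources are allowed), with vertex matrix $A(v,w)=|\{e\in E^1: r(e)=v,\ s(e)=w\}|$, and let $\rho(A)$ be the spectral radius of $A$ (with $\ln 0=-\infty$). A Toeplitz-Cuntz-Krieger $E$-family in a $C^*$-algebra consists of mutually orthogonal projections $P_v$ ($v\in E^0$) and partial isometries $S_e$ ($e\in E^1$) with $S_e^*S_e=P_{s(e)}$ for all $e\in E^1$ and $P_v\ge\sum_{r(e)=v}S_eS_e^*$ for all $v\in E^0$. Let $\mathcal{T}C^*(E)$ be the Toeplitz algebra of $E$, that is, the $C^*$-algebra generated by a universal Toeplitz-Cuntz-Krieger $E$-family $(p,s)$. Let $\alpha:\mathbb{R}\to\operatorname{Aut}\mathcal{T}C^*(E)$ be the dynamics with $\alpha_t(p_v)=p_v$ and $\alpha_t(s_e)=e^{it}s_e$. A KMS$_\beta$ state of $(\mathcal{T}C^*(E),\alpha)$ is a state $\phi$ such that $\phi(ab)=\phi(b\,\alpha_{i\beta}(a))$ for all elements $a,b$ that are analytic for $\alpha$ (i.e. $t\mapsto\alpha_t(a)$ extends to an entire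 function $z\mapsto\alpha_z(a)$). Suppose that $\beta\in(0,\infty)$ satisfies $\beta\ge\ln\rho(A)$. Then the map $\phi\mapsto m^\phi:=(\phi(p_v))_{v\in E^0}$ is a bijection of the set of KMS$_\beta$ states of $(\mathcal{T}C^*(E),\alpha)$ onto the set of unit vectors $m$ in $[0,\infty)^{E^0}\subset\ell^1(E^0)$ that satisfy the subinvariance relation $Am\le e^\beta m$ (entrywise). Moreover, if $\beta=\ln\rho(A)$, then for every sequence $(\beta_n)$ that decreases strictly to $\beta$ there are KMS$_{\beta_n}$ states $\psi_n$ of $(\mathcal{T}C^*(E),\alpha)$ that converge in the weak* topology to a KMS$_\beta$ state; in particular KMS$_{\ln\rho(A)}$ states exist. -/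

import Mathlib

open scoped ComplexOrder ENNReal
open Filter Topology

universe u

noncomputable section

/-- A directed graph `(E⁰, E¹, r, s)` with vertex set `V` and edge set `Ed`; loops and parallel
edges are allowed. -/
structure DirectedGraph (V Ed : Type u) where
  /-- the range map -/
  r : Ed → V
  /-- the source map -/
  s : Ed → V

namespace DirectedGraph

variable {V Ed : Type u} [Fintype Ed]

/-- The vertex matrix: `A(v, w)` is the number of edges `e` with `r(e) = v` and `s(e) = w`. -/
def vertexMatrix (E : DirectedGraph V Ed) : Matrix V V ℕ :=
  fun v w => Nat.card {e : Ed // E.r e = v ∧ E.s e = w}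

open Classical in
/-- `∑_{r(e) = v} S_e S_e^*`. -/
def rangeSum (E : DirectedGraph V Ed) {B : Type*} [NonUnitalCStarAlgebra B] (S : Ed → B) (v : V) :
    B :=
  ∑ e ∈ Finset.univ.filter (fun e => E.r e = v), S e * star (S e)

/-- A Toeplitz-Cuntz-Krieger `E`-family in a C⋆-algebra `B` (not assumed to be unital): mutually
orthogonal projections `P v` and partial isometries `S e` with `S_e^* S_e = P_{s(e)}` and
`P_v ≥ ∑_{r(e) = v} S_e S_e^*`. The last inequality says that the difference is a positive element,
that is, of the form `b^* b`. -/
structure TCKFamily (E : DirectedGraph V Ed) (B : Type*) [NonUnitalCStarAlgebra B] where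
  P : V → B
  S : Ed → B
  isStarProjection : ∀ v, IsStarProjection (P v)
  orthogonal : ∀ v w, v ≠ w → P v * P w = 0
  partialIsometry : ∀ e, S e * star (S e) * S e = S e
  star_mul_self : ∀ e, star (S e) * S e = P (E.s e)
  gap_nonneg : ∀ v, ∃ b : B, P v - E.rangeSum S v = star b * b

end DirectedGraph

/-- Formal noncommutative *-polynomials in the vertices and edges (without constant term). -/
inductive StarPoly (V Ed : Type u) : Type u
  | vert (v : V)
  | edge (e : Ed)
  | zero
  | add (a b : StarPoly V Ed)
  | mul (a b : StarPoly V Ed)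
  | smul (c : ℂ) (a : StarPoly V Ed)
  | star (a : StarPoly V Ed)

namespace StarPoly

variable {V Ed : Type u}

/-- Evaluation of a *-polynomial at elements `P v`, `S e` of a C⋆-algebra. -/
def eval {B : Type*} [NonUnitalCStarAlgebra B] (P : V → B) (S : Ed → B) : StarPoly V Ed → B
  | vert v => P v
  | edge e => S e
  | zero => 0
  | add a b => eval P S a + eval P S b
  | mul a b => eval P S a * eval P S b
  | smul c a => c • eval P S a
  | star a => Star.star (eval P S a)

theorem exists_eval_of_mem_adjoin {B : Type*} [NonUnitalCStarAlgebra B] (P : V → B) (S : Ed → B)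
    {x : B} (hx : x ∈ NonUnitalStarAlgebra.adjoin ℂ (Set.range P ∪ Set.range S)) :
    ∃ t : StarPoly V Ed, eval P S t = x := by
  induction hx using NonUnitalStarAlgebra.adjoin_induction with
  | mem x hx =>
    rcases hx with ⟨v, rfl⟩ | ⟨e, rfl⟩
    exacts [⟨vert v, rfl⟩, ⟨edge e, rfl⟩]
  | add x y _ _ hx hy =>
    obtain ⟨a, rfl⟩ := hx
    obtain ⟨b, rfl⟩ := hy
    exact ⟨add a b, rfl⟩
  | zero => exact ⟨zero, rfl⟩
  | mul x y _ _ hx hy =>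
    obtain ⟨a, rfl⟩ := hx
    obtain ⟨b, rfl⟩ := hy
    exact ⟨mul a b, rfl⟩
  | smul c x _ hx =>
    obtain ⟨a, rfl⟩ := hx
    exact ⟨smul c a, rfl⟩
  | star x _ hx =>
    obtain ⟨a, rfl⟩ := hx
    exact ⟨StarPoly.star a, rfl⟩

theorem map_eval {B C : Type*} [NonUnitalCStarAlgebra B] [NonUnitalCStarAlgebra C]
    (f : B →⋆ₙₐ[ℂ] C) (P : V → B) (S : Ed → B) (t : StarPoly V Ed) :
    f (eval P S t) = eval (fun v => f (P v)) (fun e => f (S e)) t := by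
  induction t with
  | vert v => rfl
  | edge e => rfl
  | zero => exact map_zero f
  | add a b ha hb => simp only [eval, map_add, ha, hb]
  | mul a b ha hb => simp only [eval, map_mul, ha, hb]
  | smul c a ha => simp only [eval, map_smul, ha]
  | star a ha => simp only [eval, map_star, ha]

end StarPoly

namespace DirectedGraph

variable {V Ed : Type u} [Fintype Ed]

namespace TCKFamily

variable {E : DirectedGraph V Ed} {B : Type*} [NonUnitalCStarAlgebra B] (F : TCKFamily E B)

theorem norm_P_le (v : V) : ‖F.P v‖ ≤ 1 := by
  have h := CStarRing.norm_star_mul_self (x := F.P v)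
  rw [(F.isStarProjection v).isSelfAdjoint.star_eq,
    (F.isStarProjection v).isIdempotentElem.eq] at h
  nlinarith [norm_nonneg (F.P v)]

theorem norm_S_le (e : Ed) : ‖F.S e‖ ≤ 1 := by
  have h := CStarRing.norm_star_mul_self (x := F.S e)
  rw [F.star_mul_self] at h
  nlinarith [norm_nonneg (F.S e), F.norm_P_le (E.s e)]

theorem rangeProj_le {v : V} [PartialOrder B] [StarOrderedRing B]
    (T : Finset Ed) (hT : ∀ e ∈ T, E.r e = v) :
    ∑ e ∈ T, F.S e * star (F.S e) ≤ F.P v := by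
  classical
  obtain ⟨b, hb⟩ := F.gap_nonneg v
  have h1 : E.rangeSum F.S v ≤ F.P v := by
    rw [← sub_nonneg, hb]
    exact star_mul_self_nonneg b
  refine le_trans ?_ h1
  refine Finset.sum_le_sum_of_subset_of_nonneg ?_ (fun _ _ _ => mul_star_self_nonneg _)
  intro e he
  simp [hT e he]

theorem P_mul_S (e : Ed) : F.P (E.r e) * F.S e = F.S e := by
  let _ := CStarAlgebra.spectralOrder B
  have _ := CStarAlgebra.spectralOrderedRing B
  have hP := F.isStarProjection (E.r e)
  have hPP : F.P (E.r e) * F.P (E.r e) = F.P (E.r e) := hP.isIdempotentElem.eq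
  have h := F.rangeProj_le (v := E.r e) {e} (by simp)
  rw [Finset.sum_singleton] at h
  set c := F.S e - F.P (E.r e) * F.S e with hc
  have hPc : F.P (E.r e) * c = 0 := by
    rw [hc, mul_sub, ← mul_assoc, hPP, sub_self]
  have h2 := star_left_conjugate_le_conjugate h c
  rw [mul_assoc (star c) (F.P _) c, hPc, mul_zero] at h2
  have h3 : star c * (F.S e * star (F.S e)) * c = star (star (F.S e) * c) * (star (F.S e) * c) := by
    simp [mul_assoc]
  rw [h3] at h2
  have h4 : star (F.S e) * c = 0 := by
    rw [← CStarRing.star_mul_self_eq_zero_iff]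
    exact le_antisymm h2 (star_mul_self_nonneg _)
  have h5 : c = 0 := by
    rw [← CStarRing.star_mul_self_eq_zero_iff]
    have : star c = star (F.S e) - star (F.S e) * F.P (E.r e) := by
      rw [hc, star_sub, star_mul, hP.isSelfAdjoint.star_eq]
    rw [this, sub_mul, h4, mul_assoc, hPc, mul_zero, sub_zero]
  exact (sub_eq_zero.mp h5).symm

theorem star_S_mul_S_of_ne {e f : Ed} (hef : e ≠ f) (hr : E.r e = E.r f) :
    star (F.S f) * F.S e = 0 := by
  classical
  let _ := CStarAlgebra.spectralOrder B
  have _ := CStarAlgebra.spectralOrderedRing B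
  have h := F.rangeProj_le (v := E.r e) {e, f} (by simp [hr])
  rw [Finset.sum_pair hef] at h
  have h2 := star_left_conjugate_le_conjugate h (F.S e)
  rw [mul_assoc (star (F.S e)) (F.P _), F.P_mul_S, mul_add, add_mul,
    mul_assoc (star (F.S e)) (F.S e * _), F.partialIsometry] at h2
  have h3 : star (F.S e) * (F.S f * star (F.S f)) * F.S e
      = star (star (F.S f) * F.S e) * (star (F.S f) * F.S e) := by
    simp [mul_assoc]
  rw [h3] at h2
  rw [← CStarRing.star_mul_self_eq_zero_iff]
  refine le_antisymm ?_ (star_mul_self_nonneg _)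
  simpa using h2

theorem P_mul_rangeSum (v : V) : F.P v * E.rangeSum F.S v = E.rangeSum F.S v := by
  classical
  unfold rangeSum
  rw [Finset.mul_sum]
  refine Finset.sum_congr rfl fun e he => ?_
  obtain rfl : E.r e = v := by simpa using he
  rw [← mul_assoc, F.P_mul_S]

theorem star_rangeSum (v : V) : star (E.rangeSum F.S v) = E.rangeSum F.S v := by
  simp [rangeSum]

theorem rangeSum_mul_self (v : V) :
    E.rangeSum F.S v * E.rangeSum F.S v = E.rangeSum F.S v := by
  classical
  unfold rangeSum
  rw [Finset.sum_mul]
  refine Finset.sum_congr rfl fun e he => ?_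
  rw [Finset.mul_sum, Finset.sum_eq_single_of_mem e he]
  · rw [← mul_assoc, F.partialIsometry]
  · intro f hf hfe
    have h : E.r f = E.r e := by
      rw [(Finset.mem_filter.mp hf).2, (Finset.mem_filter.mp he).2]
    have := F.star_S_mul_S_of_ne hfe h
    rw [mul_assoc, ← mul_assoc (star _), this, zero_mul, mul_zero]

/-- The gap projections are indeed projections. -/
theorem gap_isStarProjection (v : V) : IsStarProjection (F.P v - E.rangeSum F.S v) := by
  have hP := F.isStarProjection v
  have h1 := F.P_mul_rangeSum v
  have h2 : E.rangeSum F.S v * F.P v = E.rangeSum F.S v := by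
    have := congrArg star h1
    rwa [star_mul, F.star_rangeSum, hP.isSelfAdjoint.star_eq] at this
  refine ⟨?_, ?_⟩
  · change _ * _ = _
    rw [mul_sub, sub_mul, sub_mul, h1, h2, F.rangeSum_mul_self, hP.isIdempotentElem.eq]
    simp
  · change star _ = _
    rw [star_sub, F.star_rangeSum, hP.isSelfAdjoint.star_eq]

end TCKFamily

/-- `N` is the seminorm on *-polynomials given by some Toeplitz-Cuntz-Krieger `E`-family. -/
def IsFamilyNorm (E : DirectedGraph V Ed) (N : StarPoly V Ed → ℝ) : Prop :=
  ∃ (B : Type u) (_ : NonUnitalCStarAlgebra B) (F : TCKFamily E B),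
    ∀ t, N t = ‖StarPoly.eval F.P F.S t‖

/-- The set of all seminorms on *-polynomials given by Toeplitz-Cuntz-Krieger `E`-families in
arbitrary C⋆-algebras. -/
def FamilyNorm (E : DirectedGraph V Ed) : Type u := {N : StarPoly V Ed → ℝ // IsFamilyNorm E N}

/-- A C⋆-algebra that carries a family with the given seminorm. -/
def FamilyNorm.Alg {E : DirectedGraph V Ed} (i : FamilyNorm E) : Type u := i.2.choose

instance {E : DirectedGraph V Ed} (i : FamilyNorm E) : NonUnitalCStarAlgebra i.Alg :=
  i.2.choose_spec.choose

/-- A family with the given seminorm. -/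
def FamilyNorm.fam {E : DirectedGraph V Ed} (i : FamilyNorm E) : TCKFamily E i.Alg :=
  i.2.choose_spec.choose_spec.choose

theorem FamilyNorm.norm_eval {E : DirectedGraph V Ed} (i : FamilyNorm E) (t : StarPoly V Ed) :
    i.1 t = ‖StarPoly.eval i.fam.P i.fam.S t‖ :=
  i.2.choose_spec.choose_spec.choose_spec t

/-- The C⋆-algebra of bounded sequences over all seminorms. -/
abbrev Ambient (E : DirectedGraph V Ed) : Type u := lp (fun i : FamilyNorm E => i.Alg) ∞

/-- The direct sum of the vertex projections. -/
def ambientP (E : DirectedGraph V Ed) (v : V) : Ambient E :=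
  ⟨fun i => i.fam.P v, memℓp_infty ⟨1, by rintro _ ⟨i, rfl⟩; exact i.fam.norm_P_le v⟩⟩

/-- The direct sum of the edge partial isometries. -/
def ambientS (E : DirectedGraph V Ed) (e : Ed) : Ambient E :=
  ⟨fun i => i.fam.S e, memℓp_infty ⟨1, by rintro _ ⟨i, rfl⟩; exact i.fam.norm_S_le e⟩⟩

/-- The C⋆-subalgebra generated by the direct sum of all families. -/
def toeplitzSubalgebra (E : DirectedGraph V Ed) : NonUnitalStarSubalgebra ℂ (Ambient E) :=
  (NonUnitalStarAlgebra.adjoin ℂ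
    (Set.range (ambientP E) ∪ Set.range (ambientS E))).topologicalClosure

/-- The Toeplitz algebra `𝒯C*(E)`: the C⋆-algebra generated by a universal
Toeplitz-Cuntz-Krieger `E`-family. It is the completion of the *-polynomials in the supremum of the
seminorms of all families, realised in the direct sum of these families; the universal property is
`exists_unique_lift`. -/
def ToeplitzAlgebra (E : DirectedGraph V Ed) : Type u := toeplitzSubalgebra E

instance (E : DirectedGraph V Ed) : NonUnitalCStarAlgebra (ToeplitzAlgebra E) :=
  NonUnitalStarSubalgebra.nonUnitalCStarAlgebra (toeplitzSubalgebra E)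
    (h_closed := NonUnitalStarSubalgebra.isClosed_topologicalClosure _)

namespace ToeplitzAlgebra

variable (E : DirectedGraph V Ed)

/-- The inclusion into the direct sum. -/
def incl : ToeplitzAlgebra E →⋆ₙₐ[ℂ] Ambient E :=
  NonUnitalStarSubalgebraClass.subtype (toeplitzSubalgebra E)

theorem incl_injective : Function.Injective (incl E) := Subtype.val_injective

/-- The universal vertex projection `p_v`. -/
def p (v : V) : ToeplitzAlgebra E :=
  ⟨ambientP E v, NonUnitalStarSubalgebra.le_topologicalClosure _
    (NonUnitalStarAlgebra.subset_adjoin ℂ _ (Or.inl ⟨v, rfl⟩))⟩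

/-- The universal edge partial isometry `s_e`. -/
def s (e : Ed) : ToeplitzAlgebra E :=
  ⟨ambientS E e, NonUnitalStarSubalgebra.le_topologicalClosure _
    (NonUnitalStarAlgebra.subset_adjoin ℂ _ (Or.inr ⟨e, rfl⟩))⟩

/-- The `i`-th coordinate. -/
def coord (i : FamilyNorm E) : ToeplitzAlgebra E →⋆ₙₐ[ℂ] i.Alg where
  toFun x := (incl E x : ∀ i : FamilyNorm E, i.Alg) i
  map_smul' _ _ := rfl
  map_zero' := rfl
  map_add' _ _ := rfl
  map_mul' _ _ := rfl
  map_star' _ := rfl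

variable {E}

theorem ext_coord {x y : ToeplitzAlgebra E} (h : ∀ i, coord E i x = coord E i y) : x = y :=
  incl_injective E (lp.ext (funext h))

theorem coord_rangeSum (i : FamilyNorm E) (v : V) :
    coord E i (E.rangeSum (s E) v) = E.rangeSum i.fam.S v := by
  simp only [rangeSum, map_sum, map_mul, map_star]
  rfl

variable (E)

/-- The universal Toeplitz-Cuntz-Krieger `E`-family `(p, s)` in `𝒯C*(E)`. -/
def univFamily : TCKFamily E (ToeplitzAlgebra E) where
  P := p E
  S := s E
  isStarProjection v :=
    ⟨ext_coord fun i => (map_mul (coord E i) _ _).trans (i.fam.isStarProjection v).isIdempotentElem,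
     ext_coord fun i => (map_star (coord E i) _).trans (i.fam.isStarProjection v).isSelfAdjoint⟩
  orthogonal v w hvw := ext_coord fun i => by
    rw [map_mul, map_zero]
    exact i.fam.orthogonal v w hvw
  partialIsometry e := ext_coord fun i => by
    rw [map_mul, map_mul, map_star]
    exact i.fam.partialIsometry e
  star_mul_self e := ext_coord fun i => by
    rw [map_mul, map_star]
    exact i.fam.star_mul_self e
  gap_nonneg v := by
    refine ⟨p E v - E.rangeSum (s E) v, ext_coord fun i => ?_⟩
    rw [map_mul, map_star, map_sub, coord_rangeSum]
    have h := i.fam.gap_isStarProjection v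
    change i.fam.P v - E.rangeSum i.fam.S v = star (i.fam.P v - E.rangeSum i.fam.S v) *
      (i.fam.P v - E.rangeSum i.fam.S v)
    rw [h.isSelfAdjoint.star_eq, h.isIdempotentElem.eq]

/-- `𝒯C*(E)` is generated by `(p, s)`. -/
theorem adjoin_closure_eq_top :
    (NonUnitalStarAlgebra.adjoin ℂ (Set.range (p E) ∪ Set.range (s E))).topologicalClosure
      = ⊤ := by
  rw [eq_top_iff]
  rintro ⟨x, hx⟩ -
  have hemb : Topology.IsInducing (incl E) := Topology.IsInducing.subtypeVal
  change _ ∈ closure _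
  rw [hemb.closure_eq_preimage_closure_image]
  change x ∈ closure _
  refine closure_mono ?_ hx
  intro y hy
  have : (NonUnitalStarAlgebra.adjoin ℂ
      (Set.range (ambientP E) ∪ Set.range (ambientS E))) ≤
      (NonUnitalStarAlgebra.adjoin ℂ (Set.range (p E) ∪ Set.range (s E))).map (incl E) := by
    refine NonUnitalStarAlgebra.adjoin_le ?_
    rintro _ (⟨v, rfl⟩ | ⟨e, rfl⟩)
    · exact ⟨p E v, NonUnitalStarAlgebra.subset_adjoin ℂ _ (Or.inl ⟨v, rfl⟩), rfl⟩
    · exact ⟨s E e, NonUnitalStarAlgebra.subset_adjoin ℂ _ (Or.inr ⟨e, rfl⟩), rfl⟩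
  exact this hy

variable {E}

theorem norm_eval_le {B : Type u} [NonUnitalCStarAlgebra B] (F : TCKFamily E B)
    (t : StarPoly V Ed) : ‖StarPoly.eval F.P F.S t‖ ≤ ‖StarPoly.eval (p E) (s E) t‖ := by
  let i : FamilyNorm E := ⟨fun t => ‖StarPoly.eval F.P F.S t‖, B, inferInstance, F, fun _ => rfl⟩
  have h1 : ‖StarPoly.eval F.P F.S t‖ = ‖StarPoly.eval i.fam.P i.fam.S t‖ := i.norm_eval t
  have h2 : coord E i (StarPoly.eval (p E) (s E) t) = StarPoly.eval i.fam.P i.fam.S t :=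
    StarPoly.map_eval _ _ _ _
  rw [h1, ← h2]
  exact lp.norm_apply_le_norm ENNReal.top_ne_zero (incl E (StarPoly.eval (p E) (s E) t)) i

/-- The graph of the homomorphism determined by a family. -/
def liftGraph {B : Type u} [NonUnitalCStarAlgebra B] (F : TCKFamily E B) :
    NonUnitalStarSubalgebra ℂ (ToeplitzAlgebra E × B) :=
  (NonUnitalStarAlgebra.adjoin ℂ
    (Set.range (fun v => (p E v, F.P v)) ∪ Set.range (fun e => (s E e, F.S e)))).topologicalClosure

theorem norm_snd_le {B : Type u} [NonUnitalCStarAlgebra B] (F : TCKFamily E B)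
    {x : ToeplitzAlgebra E × B} (hx : x ∈ liftGraph F) : ‖x.2‖ ≤ ‖x.1‖ := by
  have hcl : IsClosed {x : ToeplitzAlgebra E × B | ‖x.2‖ ≤ ‖x.1‖} :=
    isClosed_le (by fun_prop) (by fun_prop)
  refine closure_minimal ?_ hcl hx
  intro y hy
  obtain ⟨t, rfl⟩ := StarPoly.exists_eval_of_mem_adjoin _ _ hy
  have h1 := StarPoly.map_eval (NonUnitalStarAlgHom.fst ℂ (ToeplitzAlgebra E) B)
    (fun v => (p E v, F.P v)) (fun e => (s E e, F.S e)) t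
  have h2 := StarPoly.map_eval (NonUnitalStarAlgHom.snd ℂ (ToeplitzAlgebra E) B)
    (fun v => (p E v, F.P v)) (fun e => (s E e, F.S e)) t
  simp only [NonUnitalStarAlgHom.fst_apply, NonUnitalStarAlgHom.snd_apply] at h1 h2
  change ‖_‖ ≤ ‖_‖
  rw [h1, h2]
  exact norm_eval_le F t

theorem exists_lift {B : Type u} [NonUnitalCStarAlgebra B] (F : TCKFamily E B) :
    ∃ π : ToeplitzAlgebra E →⋆ₙₐ[ℂ] B, (∀ v, π (p E v) = F.P v) ∧ ∀ e, π (s E e) = F.S e := by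
  let G := liftGraph F
  have hGc : IsClosed (G : Set (ToeplitzAlgebra E × B)) :=
    NonUnitalStarSubalgebra.isClosed_topologicalClosure _
  have hP : ∀ v, (p E v, F.P v) ∈ G := fun v =>
    NonUnitalStarSubalgebra.le_topologicalClosure _
      (NonUnitalStarAlgebra.subset_adjoin ℂ _ (Or.inl ⟨v, rfl⟩))
  have hS : ∀ e, (s E e, F.S e) ∈ G := fun e =>
    NonUnitalStarSubalgebra.le_topologicalClosure _
      (NonUnitalStarAlgebra.subset_adjoin ℂ _ (Or.inr ⟨e, rfl⟩))
  let ι := NonUnitalStarSubalgebraClass.subtype G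
  let f₁ : G →⋆ₙₐ[ℂ] ToeplitzAlgebra E := (NonUnitalStarAlgHom.fst ℂ (ToeplitzAlgebra E) B).comp ι
  let f₂ : G →⋆ₙₐ[ℂ] B := (NonUnitalStarAlgHom.snd ℂ (ToeplitzAlgebra E) B).comp ι
  have hiso : Isometry f₁ := by
    refine AddMonoidHomClass.isometry_of_norm f₁ fun x => ?_
    have h := norm_snd_le F x.2
    change ‖x.1.1‖ = max ‖x.1.1‖ ‖x.1.2‖
    exact (max_eq_left h).symm
  have : CompleteSpace G := hGc.completeSpace_coe
  have hrc : IsClosed (Set.range f₁) := hiso.isClosedEmbedding.isClosed_range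
  have hsurj : Function.Surjective f₁ := by
    have hle : (⊤ : NonUnitalStarSubalgebra ℂ (ToeplitzAlgebra E)) ≤ NonUnitalStarAlgHom.range f₁ := by
      rw [← adjoin_closure_eq_top E]
      refine NonUnitalStarSubalgebra.topologicalClosure_minimal _ ?_ hrc
      refine NonUnitalStarAlgebra.adjoin_le ?_
      rintro _ (⟨v, rfl⟩ | ⟨e, rfl⟩)
      · exact ⟨⟨_, hP v⟩, rfl⟩
      · exact ⟨⟨_, hS e⟩, rfl⟩
    intro x
    exact hle (x := x) trivial
  let eqv := StarAlgEquiv.ofBijective f₁ ⟨hiso.injective, hsurj⟩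
  have key : ∀ g : G, eqv.symm (f₁ g) = g := fun g => eqv.symm_apply_apply g
  refine ⟨f₂.comp (eqv.symm : ToeplitzAlgebra E →⋆ₙₐ[ℂ] G), fun v => ?_, fun e => ?_⟩
  · exact congrArg f₂ (key ⟨_, hP v⟩)
  · exact congrArg f₂ (key ⟨_, hS e⟩)

theorem hom_ext {B : Type*} [NonUnitalCStarAlgebra B] {π ρ : ToeplitzAlgebra E →⋆ₙₐ[ℂ] B}
    (hp : ∀ v, π (p E v) = ρ (p E v)) (hs : ∀ e, π (s E e) = ρ (s E e)) : π = ρ := by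
  have hcl : IsClosed {x | π x = ρ x} :=
    isClosed_eq (NonUnitalStarAlgHom.instContinuousLinearMapClassComplex.map_continuous π)
      (NonUnitalStarAlgHom.instContinuousLinearMapClassComplex.map_continuous ρ)
  ext x
  have hx : x ∈ (NonUnitalStarAlgebra.adjoin ℂ
      (Set.range (p E) ∪ Set.range (s E))).topologicalClosure := by
    rw [adjoin_closure_eq_top]; trivial
  refine closure_minimal ?_ hcl hx
  intro y hy
  obtain ⟨t, rfl⟩ := StarPoly.exists_eval_of_mem_adjoin _ _ hy
  change π _ = ρ _
  rw [StarPoly.map_eval, StarPoly.map_eval, funext hp, funext hs]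

/-- The universal property of `𝒯C*(E)`. -/
theorem exists_unique_lift {B : Type u} [NonUnitalCStarAlgebra B] (F : TCKFamily E B) :
    ∃! π : ToeplitzAlgebra E →⋆ₙₐ[ℂ] B, (∀ v, π (p E v) = F.P v) ∧ ∀ e, π (s E e) = F.S e := by
  obtain ⟨π, hπ⟩ := exists_lift F
  refine ⟨π, hπ, fun ρ hρ => hom_ext (fun v => ?_) (fun e => ?_)⟩
  · rw [hρ.1, hπ.1]
  · rw [hρ.2, hπ.2]

/-- The homomorphism `π_{P,S}` determined by a Toeplitz-Cuntz-Krieger family. -/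
def lift {B : Type u} [NonUnitalCStarAlgebra B] (F : TCKFamily E B) :
    ToeplitzAlgebra E →⋆ₙₐ[ℂ] B :=
  (exists_lift F).choose

theorem lift_p {B : Type u} [NonUnitalCStarAlgebra B] (F : TCKFamily E B) (v : V) :
    lift F (p E v) = F.P v := (exists_lift F).choose_spec.1 v

theorem lift_s {B : Type u} [NonUnitalCStarAlgebra B] (F : TCKFamily E B) (e : Ed) :
    lift F (s E e) = F.S e := (exists_lift F).choose_spec.2 e

variable (E)

theorem star_smul_mul (z : Circle) (x y : ToeplitzAlgebra E) :
    ((z : ℂ) • x) * star ((z : ℂ) • y) = x * star y := by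
  have hz : (z : ℂ) * star (z : ℂ) = 1 := by
    rw [Complex.star_def, Complex.mul_conj, Circle.normSq_coe, Complex.ofReal_one]
  rw [star_smul, smul_mul_smul_comm, hz, one_smul]

/-- The family `(p, z s)` for `z` in the circle. -/
def rotatedFamily (z : Circle) : TCKFamily E (ToeplitzAlgebra E) where
  P := p E
  S e := (z : ℂ) • s E e
  isStarProjection := (univFamily E).isStarProjection
  orthogonal := (univFamily E).orthogonal
  partialIsometry e := by
    rw [star_smul_mul, mul_smul_comm]
    exact congrArg _ ((univFamily E).partialIsometry e)
  star_mul_self e := by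
    have hz : star (z : ℂ) * (z : ℂ) = 1 := by
      rw [mul_comm, Complex.star_def, Complex.mul_conj, Circle.normSq_coe, Complex.ofReal_one]
    rw [star_smul, smul_mul_smul_comm, hz, one_smul]
    exact (univFamily E).star_mul_self e
  gap_nonneg v := by
    have h : E.rangeSum (fun e => (z : ℂ) • s E e) v = E.rangeSum (s E) v := by
      simp only [rangeSum, star_smul_mul]
    rw [h]
    exact (univFamily E).gap_nonneg v

theorem lift_rotated_comp (z w : Circle) :
    (lift (rotatedFamily E z)).comp (lift (rotatedFamily E w)) = lift (rotatedFamily E (z * w)) := by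
  refine hom_ext (fun v => ?_) (fun e => ?_)
  · simp only [NonUnitalStarAlgHom.comp_apply, lift_p, rotatedFamily]
  · simp only [NonUnitalStarAlgHom.comp_apply, lift_s, rotatedFamily, map_smul, Circle.coe_mul,
      mul_smul]
    rw [smul_comm]

theorem lift_rotated_one : lift (rotatedFamily E 1) = NonUnitalStarAlgHom.id ℂ _ := by
  refine hom_ext (fun v => lift_p _ v) (fun e => ?_)
  rw [lift_s]
  simp [rotatedFamily]

/-- The gauge action `γ` of the circle on `𝒯C*(E)`: `γ_z(p_v) = p_v` and `γ_z(s_e) = z s_e`. -/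
def gauge (z : Circle) : ToeplitzAlgebra E ≃⋆ₐ[ℂ] ToeplitzAlgebra E :=
  StarAlgEquiv.ofBijective (lift (rotatedFamily E z)) <| by
    refine Function.bijective_iff_has_inverse.mpr ⟨lift (rotatedFamily E z⁻¹), fun x => ?_, fun x => ?_⟩
    · have h := lift_rotated_comp E z⁻¹ z
      rw [inv_mul_cancel, lift_rotated_one] at h
      exact DFunLike.congr_fun h x
    · have h := lift_rotated_comp E z z⁻¹
      rw [mul_inv_cancel, lift_rotated_one] at h
      exact DFunLike.congr_fun h x

theorem gauge_p (z : Circle) (v : V) : gauge E z (p E v) = p E v := lift_p _ v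

theorem gauge_s (z : Circle) (e : Ed) : gauge E z (s E e) = (z : ℂ) • s E e := lift_s _ e

/-- The dynamics `α_t = γ_{e^{it}}` on `𝒯C*(E)`. -/
def dynamics (t : ℝ) : ToeplitzAlgebra E ≃⋆ₐ[ℂ] ToeplitzAlgebra E := gauge E (Circle.exp t)

end ToeplitzAlgebra

end DirectedGraph

section KMS

variable {A : Type*} [NonUnitalCStarAlgebra A]

/-- A state of a C⋆-algebra: a positive linear functional of norm one. -/
def IsState (φ : A →L[ℂ] ℂ) : Prop := (∀ a, 0 ≤ φ (star a * a)) ∧ ‖φ‖ = 1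

/-- `f` is the entire function `z ↦ α_z(a)` extending `t ↦ α_t(a)`; the element `a` is analytic for
`α` if such an `f` exists. -/
def IsEntireExtension (α : ℝ → A ≃⋆ₐ[ℂ] A) (a : A) (f : ℂ → A) : Prop :=
  Differentiable ℂ f ∧ ∀ t : ℝ, f (t : ℂ) = α t a

/-- `φ` is a KMS state of `(A, α)` at inverse temperature `β`: a state with
`φ(a b) = φ(b α_{iβ}(a))` for all analytic elements `a` and `b`. -/
def IsKMSState (α : ℝ → A ≃⋆ₐ[ℂ] A) (β : ℝ) (φ : A →L[ℂ] ℂ) : Prop :=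
  IsState φ ∧ ∀ (a b : A) (f g : ℂ → A), IsEntireExtension α a f → IsEntireExtension α b g →
    φ (a * b) = φ (b * f (Complex.I * β))

end KMS

/-- The KMS states at inverse temperature `β` of `(𝒯C*(E), α)`. -/
def DirectedGraph.kmsStates {V Ed : Type u} [Fintype Ed] (E : DirectedGraph V Ed) (β : ℝ) :
    Set (E.ToeplitzAlgebra →L[ℂ] ℂ) :=
  {φ | IsKMSState (DirectedGraph.ToeplitzAlgebra.dynamics E) β φ}

/-- The unit vectors `m` of `ℓ¹(E⁰)` with nonnegative entries and `A m ≤ e^β m`. -/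
def DirectedGraph.subinvariantUnitVectors {V Ed : Type u} [Fintype V] [Fintype Ed]
    (E : DirectedGraph V Ed) (β : ℝ) : Set (V → ℝ) :=
  {m | (∀ v, 0 ≤ m v) ∧ ∑ v, |m v| = 1 ∧
    ∀ v, ((E.vertexMatrix.map (Nat.cast : ℕ → ℝ)).mulVec m) v ≤ Real.exp β * m v}

/-- `ln ρ(A)` for the vertex matrix `A`, where `ρ(A)` is the spectral radius of `A` as a complex
matrix; it is `-∞` if `ρ(A) = 0`. -/
def DirectedGraph.logSpectralRadius {V Ed : Type u} [Fintype V] [DecidableEq V] [Fintype Ed]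
    (E : DirectedGraph V Ed) : EReal :=
  ENNReal.log (spectralRadius ℂ (E.vertexMatrix.map (Nat.cast : ℕ → ℂ)))

end

/-! Put c = e^{-β}, so 0 < c < 1. The products μν^* of words in the generators span a dense
subspace, so a functional is determined by its values there. The argument replaces the KMS condition
by an algebraic one, `IsTwistedTrace`: φ(s_e b) = c φ(b s_e), φ commutes with the p_v, and φ is
hermitian. For states the two are equivalent: monomials are eigenvectors of the dynamics, and the
identity theorem for entire functions recovers the condition for arbitrary analytic elements.

Uniqueness: cancelling leading edges with the twisted trace relation reduces φ(μν^*) to a power of c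
times a vertex value, or to 0. Words of positive length are killed because φ(μ) = c^{|μ|} φ(μ) with
c^{|μ|} < 1. Thus φ is determined by (φ(p_v)), continuously in c and in these values
(`tendsto_monomial`). The vertex vector is subinvariant because φ is nonnegative on the gap p_v - ∑
s_e s_e^*, where it takes the value m_v - c (Am)_v.

Existence: in the Fock representation, path vectors give positive functionals. Giving every path μ
the weight c^{|μ|} (m - cAm)(s(μ)) may lose mass in the limit, for instance all of it when Am = e^β
m. Paths are therefore cut off at length N and the remaining mass c^N m(s(μ)) is placed on the paths
of length N. The functional then has the vertex values m for every N and satisfies the trace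
relation up to a shift from N + 1 to N (`approxState_succ_s_mul`). On each monomial it is eventually
constant in N, and the limit is the required state.

At β = ln ρ(A), Gelfand's formula and a truncated Neumann series give subinvariant vectors for each
larger parameter, and compactness of the simplex gives one for β. That vector m remains subinvariant
at every β_n, and the KMS states with this common vertex vector converge. -/

noncomputable section

namespace DirectedGraph

namespace ToeplitzAlgebra

variable {V Ed : Type u} [Fintype Ed]

/-! ### Relations among the generators and the span of the monomials μν^*. -/

section Relations

variable (E : DirectedGraph V Ed)

theorem star_p (v : V) : star (p E v) = p E v :=
  ((univFamily E).isStarProjection v).isSelfAdjoint.star_eq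

theorem p_mul_self (v : V) : p E v * p E v = p E v :=
  ((univFamily E).isStarProjection v).isIdempotentElem.eq

theorem p_mul_p_of_ne {v w : V} (h : v ≠ w) : p E v * p E w = 0 :=
  (univFamily E).orthogonal v w h

theorem norm_s_le (e : Ed) : ‖s E e‖ ≤ 1 := (univFamily E).norm_S_le e

theorem star_s_mul_self (e : Ed) : star (s E e) * s E e = p E (E.s e) :=
  (univFamily E).star_mul_self e

theorem s_mul_p (e : Ed) : s E e * p E (E.s e) = s E e := by
  rw [← star_s_mul_self, ← mul_assoc]
  exact (univFamily E).partialIsometry e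

theorem p_mul_s (e : Ed) : p E (E.r e) * s E e = s E e := (univFamily E).P_mul_S e

theorem p_mul_s_of_ne {v : V} {e : Ed} (h : v ≠ E.r e) : p E v * s E e = 0 := by
  rw [← p_mul_s, ← mul_assoc, p_mul_p_of_ne E h, zero_mul]

theorem star_s_mul_p (e : Ed) : star (s E e) * p E (E.r e) = star (s E e) := by
  conv_rhs => rw [← p_mul_s, star_mul, star_p]

theorem star_s_mul_p_of_ne {v : V} {e : Ed} (h : v ≠ E.r e) : star (s E e) * p E v = 0 := by
  have := congrArg star (p_mul_s_of_ne E h)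
  rwa [star_mul, star_p, star_zero] at this

theorem star_s_mul_s_of_ne {e f : Ed} (h : f ≠ e) : star (s E e) * s E f = 0 := by
  by_cases hr : E.r f = E.r e
  · exact (univFamily E).star_S_mul_S_of_ne h hr
  · rw [← star_s_mul_p, mul_assoc, p_mul_s_of_ne E (Ne.symm hr), mul_zero]

/-- The element `s_{e₁} ⋯ s_{eₙ} p_w`, which vanishes if `e₁ ⋯ eₙ` is not a path with source
`w`. -/
def word : List Ed → V → ToeplitzAlgebra E
  | [], w => p E w
  | e :: l, w => s E e * word l w

theorem word_nil (w : V) : word E [] w = p E w := rfl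

theorem word_cons (e : Ed) (l : List Ed) (w : V) : word E (e :: l) w = s E e * word E l w := rfl

theorem word_mul_p (l : List Ed) (w : V) : word E l w * p E w = word E l w := by
  induction l with
  | nil => exact p_mul_self E w
  | cons e l ih => rw [word_cons, mul_assoc, ih]

theorem word_mul_p_of_ne (l : List Ed) {v w : V} (h : v ≠ w) : word E l v * p E w = 0 := by
  rw [← word_mul_p, mul_assoc, p_mul_p_of_ne E h, mul_zero]

/-- Words are built from the left; this allows an edge arriving on the right, as after a cyclic
move, to be absorbed into a word. -/
theorem word_append_singleton (l : List Ed) (e : Ed) :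
    word E (l ++ [e]) (E.s e) = word E l (E.r e) * s E e := by
  induction l with
  | nil => rw [List.nil_append, word_cons, word_nil, word_nil, s_mul_p, p_mul_s]
  | cons f l ih => rw [List.cons_append, word_cons, word_cons, ih, mul_assoc]

theorem word_mul_s_of_ne (l : List Ed) {v : V} {e : Ed} (h : v ≠ E.r e) :
    word E l v * s E e = 0 := by
  rw [← word_mul_p, mul_assoc, p_mul_s_of_ne E h, mul_zero]

theorem p_mul_word (v : V) (l : List Ed) (w : V) :
    p E v * word E l w = word E l w ∨ p E v * word E l w = 0 := by
  cases l with
  | nil =>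
    by_cases h : v = w
    · subst h; exact Or.inl (p_mul_self E v)
    · exact Or.inr (p_mul_p_of_ne E h)
  | cons e l =>
    rw [word_cons, ← mul_assoc]
    by_cases h : v = E.r e
    · subst h; rw [p_mul_s]; exact Or.inl rfl
    · rw [p_mul_s_of_ne E h, zero_mul]; exact Or.inr rfl

theorem star_s_mul_word_cons (e : Ed) (l : List Ed) (w : V) :
    star (s E e) * word E (e :: l) w = p E (E.s e) * word E l w := by
  rw [word_cons, ← mul_assoc, star_s_mul_self]

theorem star_s_mul_word_cons_of_ne {e f : Ed} (h : f ≠ e) (l : List Ed) (w : V) :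
    star (s E e) * word E (f :: l) w = 0 := by
  rw [word_cons, ← mul_assoc, star_s_mul_s_of_ne E h, zero_mul]

/-- The products `μ ν^*` of words. -/
def monomial (x : (List Ed × V) × (List Ed × V)) : ToeplitzAlgebra E :=
  word E x.1.1 x.1.2 * star (word E x.2.1 x.2.2)

/-- The linear span of the monomials. -/
def monomialSpan : Submodule ℂ (ToeplitzAlgebra E) := Submodule.span ℂ (Set.range (monomial E))

theorem word_mul_star_word_mem (l : List Ed) (v : V) (l' : List Ed) (w : V) :
    word E l v * star (word E l' w) ∈ monomialSpan E :=
  Submodule.subset_span ⟨((l, v), (l', w)), rfl⟩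

theorem p_mul_mem_monomialSpan (v : V) {x : ToeplitzAlgebra E} (hx : x ∈ monomialSpan E) :
    p E v * x ∈ monomialSpan E := by
  induction hx using Submodule.span_induction with
  | mem x hx =>
    obtain ⟨⟨⟨l, w⟩, l', w'⟩, rfl⟩ := hx
    rw [monomial, ← mul_assoc]
    rcases p_mul_word E v l w with h | h
    · rw [h]; exact word_mul_star_word_mem E _ _ _ _
    · rw [h, zero_mul]; exact zero_mem _
  | zero => rw [mul_zero]; exact zero_mem _
  | add x y _ _ hx hy => rw [mul_add]; exact add_mem hx hy
  | smul c x _ hx => rw [mul_smul_comm]; exact Submodule.smul_mem _ _ hx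

theorem s_mul_mem_monomialSpan (e : Ed) {x : ToeplitzAlgebra E} (hx : x ∈ monomialSpan E) :
    s E e * x ∈ monomialSpan E := by
  induction hx using Submodule.span_induction with
  | mem x hx =>
    obtain ⟨⟨⟨l, w⟩, l', w'⟩, rfl⟩ := hx
    rw [monomial, ← mul_assoc, ← word_cons]
    exact word_mul_star_word_mem E _ _ _ _
  | zero => rw [mul_zero]; exact zero_mem _
  | add x y _ _ hx hy => rw [mul_add]; exact add_mem hx hy
  | smul c x _ hx => rw [mul_smul_comm]; exact Submodule.smul_mem _ _ hx

theorem star_s_mul_mem_monomialSpan (e : Ed) {x : ToeplitzAlgebra E} (hx : x ∈ monomialSpan E) :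
    star (s E e) * x ∈ monomialSpan E := by
  induction hx using Submodule.span_induction with
  | mem x hx =>
    obtain ⟨⟨⟨l, w⟩, l', w'⟩, rfl⟩ := hx
    rw [monomial, ← mul_assoc]
    cases l with
    | nil =>
      -- With nothing to cancel on the left, s_e^* is absorbed into ν^*, since s_e^* ν^* = (ν
      -- s_e)^*.
      have h : star (s E e) * p E w * star (word E l' w')
          = star (word E l' w' * p E w * s E e) := by
        simp only [star_mul, star_p, mul_assoc]
      rw [word_nil, h]
      by_cases hw : w' = w
      · subst hw
        rw [word_mul_p]
        by_cases hr : w' = E.r e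
        · subst hr
          rw [← word_append_singleton, ← word_mul_p, star_mul, star_p]
          exact word_mul_star_word_mem E [] _ _ _
        · rw [word_mul_s_of_ne E _ hr, star_zero]; exact zero_mem _
      · rw [word_mul_p_of_ne E _ hw, zero_mul, star_zero]; exact zero_mem _
    | cons f l =>
      by_cases hf : f = e
      · subst hf
        rw [star_s_mul_word_cons, mul_assoc]
        exact p_mul_mem_monomialSpan E _ (word_mul_star_word_mem E _ _ _ _)
      · rw [star_s_mul_word_cons_of_ne E hf, zero_mul]; exact zero_mem _
  | zero => rw [mul_zero]; exact zero_mem _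
  | add x y _ _ hx hy => rw [mul_add]; exact add_mem hx hy
  | smul c x _ hx => rw [mul_smul_comm]; exact Submodule.smul_mem _ _ hx

/-- The statement covers a and a^* together so that the induction passes through adjoints. -/
theorem mul_mem_monomialSpan {a : ToeplitzAlgebra E}
    (ha : a ∈ NonUnitalStarAlgebra.adjoin ℂ (Set.range (p E) ∪ Set.range (s E))) :
    (∀ x ∈ monomialSpan E, a * x ∈ monomialSpan E) ∧
      ∀ x ∈ monomialSpan E, star a * x ∈ monomialSpan E := by
  induction ha using NonUnitalStarAlgebra.adjoin_induction with
  | mem x hx =>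
    rcases hx with ⟨v, rfl⟩ | ⟨e, rfl⟩
    · rw [star_p]
      exact ⟨fun x hx => p_mul_mem_monomialSpan E v hx, fun x hx => p_mul_mem_monomialSpan E v hx⟩
    · exact ⟨fun x hx => s_mul_mem_monomialSpan E e hx,
        fun x hx => star_s_mul_mem_monomialSpan E e hx⟩
  | add x y _ _ hx hy =>
    refine ⟨fun z hz => ?_, fun z hz => ?_⟩
    · rw [add_mul]; exact add_mem (hx.1 z hz) (hy.1 z hz)
    · rw [star_add, add_mul]; exact add_mem (hx.2 z hz) (hy.2 z hz)
  | zero =>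
    refine ⟨fun z hz => ?_, fun z hz => ?_⟩
    · rw [zero_mul]; exact zero_mem _
    · rw [star_zero, zero_mul]; exact zero_mem _
  | mul x y _ _ hx hy =>
    refine ⟨fun z hz => ?_, fun z hz => ?_⟩
    · rw [mul_assoc]; exact hx.1 _ (hy.1 z hz)
    · rw [star_mul, mul_assoc]; exact hy.2 _ (hx.2 z hz)
  | smul c x _ hx =>
    refine ⟨fun z hz => ?_, fun z hz => ?_⟩
    · rw [smul_mul_assoc]; exact Submodule.smul_mem _ _ (hx.1 z hz)
    · rw [star_smul, smul_mul_assoc]; exact Submodule.smul_mem _ _ (hx.2 z hz)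
  | star x _ hx => exact ⟨hx.2, by rw [star_star]; exact hx.1⟩

end Relations

/-! ### The identity ∑ p_v, density of the monomials, and convergence tested on them. -/

section FiniteVertices

variable [Fintype V] (E : DirectedGraph V Ed)

/-- The identity `∑_v p_v`. -/
def unit : ToeplitzAlgebra E := ∑ v, p E v

theorem star_unit : star (unit E) = unit E := by simp [unit, star_p]

theorem p_mul_unit (v : V) : p E v * unit E = p E v := by
  rw [unit, Finset.mul_sum, Finset.sum_eq_single_of_mem v (Finset.mem_univ v), p_mul_self]
  exact fun w _ hw => p_mul_p_of_ne E hw.symm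

theorem unit_mul_p (v : V) : unit E * p E v = p E v := by
  have := congrArg star (p_mul_unit E v)
  rwa [star_mul, star_p, star_unit] at this

theorem unit_mul_s (e : Ed) : unit E * s E e = s E e := by
  rw [← p_mul_s, ← mul_assoc, unit_mul_p]

theorem s_mul_unit (e : Ed) : s E e * unit E = s E e := by
  rw [← s_mul_p, mul_assoc, p_mul_unit]

theorem unit_mul_unit : unit E * unit E = unit E := by
  conv_rhs => rw [unit]
  conv_lhs => rw [unit, Finset.sum_mul]
  exact Finset.sum_congr rfl fun v _ => p_mul_unit E v

theorem norm_unit_le : ‖unit E‖ ≤ 1 := by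
  have h := CStarRing.norm_star_mul_self (x := unit E)
  rw [star_unit, unit_mul_unit] at h
  nlinarith [norm_nonneg (unit E)]

theorem unit_mem_monomialSpan : unit E ∈ monomialSpan E := by
  refine sum_mem fun v _ => ?_
  have := word_mul_star_word_mem E [] v [] v
  rwa [word_nil, star_p, p_mul_self] at this

theorem mul_unit_of_mem_adjoin {a : ToeplitzAlgebra E}
    (ha : a ∈ NonUnitalStarAlgebra.adjoin ℂ (Set.range (p E) ∪ Set.range (s E))) :
    a * unit E = a ∧ unit E * a = a := by
  induction ha using NonUnitalStarAlgebra.adjoin_induction with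
  | mem x hx =>
    rcases hx with ⟨v, rfl⟩ | ⟨e, rfl⟩
    · exact ⟨p_mul_unit E v, unit_mul_p E v⟩
    · exact ⟨s_mul_unit E e, unit_mul_s E e⟩
  | add x y _ _ hx hy => rw [add_mul, mul_add, hx.1, hx.2, hy.1, hy.2]; exact ⟨rfl, rfl⟩
  | zero => rw [zero_mul, mul_zero]; exact ⟨rfl, rfl⟩
  | mul x y _ _ hx hy => rw [mul_assoc, hy.1, ← mul_assoc, hx.2]; exact ⟨rfl, rfl⟩
  | smul c x _ hx => rw [smul_mul_assoc, mul_smul_comm, hx.1, hx.2]; exact ⟨rfl, rfl⟩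
  | star x _ hx =>
    have h1 := congrArg star hx.1
    have h2 := congrArg star hx.2
    rw [star_mul, star_unit] at h1 h2
    exact ⟨h2, h1⟩

/-- The span contains the identity and is stable under left multiplication by the generated
*-algebra, so it contains that algebra. -/
theorem dense_monomialSpan : Dense (monomialSpan E : Set (ToeplitzAlgebra E)) := by
  intro x
  have hx : x ∈ (NonUnitalStarAlgebra.adjoin ℂ
      (Set.range (p E) ∪ Set.range (s E))).topologicalClosure := by
    rw [adjoin_closure_eq_top]; trivial
  refine closure_mono (fun y hy => ?_) hx
  have h := (mul_mem_monomialSpan E hy).1 _ (unit_mem_monomialSpan E)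
  rwa [(mul_unit_of_mem_adjoin E hy).1] at h

variable {E}

/-- Continuous linear maps which agree on the monomials are equal. -/
theorem clm_ext_monomial {B : Type*} [NormedAddCommGroup B] [NormedSpace ℂ B]
    {φ ψ : ToeplitzAlgebra E →L[ℂ] B} (h : ∀ x, φ (monomial E x) = ψ (monomial E x)) : φ = ψ :=
  ContinuousLinearMap.ext_on (dense_monomialSpan E) (by rintro _ ⟨x, rfl⟩; exact h x)

theorem mul_unit (a : ToeplitzAlgebra E) : a * unit E = a := by
  have hcl : IsClosed {a | a * unit E = a} :=
    isClosed_eq (continuous_id.mul continuous_const) continuous_id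
  have hx : a ∈ (NonUnitalStarAlgebra.adjoin ℂ
      (Set.range (p E) ∪ Set.range (s E))).topologicalClosure := by
    rw [adjoin_closure_eq_top]; trivial
  exact closure_minimal (fun y hy => (mul_unit_of_mem_adjoin E hy).1) hcl hx

theorem unit_mul (a : ToeplitzAlgebra E) : unit E * a = a := by
  have h := congrArg star (mul_unit (star a))
  rwa [star_mul, star_unit, star_star] at h

/-- A bounded sequence of functionals converges pointwise if it does so on the monomials. -/
theorem cauchySeq_of_monomial {φ : ℕ → ToeplitzAlgebra E →L[ℂ] ℂ} (hφ : ∀ n, ‖φ n‖ ≤ 1)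
    (h : ∀ x, CauchySeq fun n => φ n (monomial E x)) (a : ToeplitzAlgebra E) :
    CauchySeq fun n => φ n a := by
  have hspan : ∀ b ∈ monomialSpan E, CauchySeq fun n => φ n b := by
    intro b hb
    induction hb using Submodule.span_induction with
    | mem x hx => obtain ⟨x, rfl⟩ := hx; exact h x
    | zero => simpa using cauchySeq_const (0 : ℂ)
    | add x y _ _ hx hy =>
      simp only [map_add]
      exact hx.add hy
    | smul c x _ hx =>
      obtain ⟨t, ht⟩ := cauchySeq_tendsto_of_complete hx
      simp only [map_smul]
      exact (ht.const_smul c).cauchySeq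
  rw [Metric.cauchySeq_iff']
  intro ε hε
  obtain ⟨b, hb, hab⟩ := Metric.dense_iff.mp (dense_monomialSpan E) a (ε / 3) (by positivity)
  rw [Metric.mem_ball, dist_eq_norm] at hb
  obtain ⟨N, hN⟩ := Metric.cauchySeq_iff'.mp (hspan b hab) (ε / 3) (by positivity)
  refine ⟨N, fun n hn => ?_⟩
  have h1 : ∀ k, ‖φ k (b - a)‖ < ε / 3 := fun k =>
    ((φ k).le_of_opNorm_le (hφ k) _).trans_lt (by rwa [one_mul])
  have h2 := hN n hn
  rw [dist_eq_norm] at h2 ⊢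
  have h3 : φ n a - φ N a = (φ n b - φ N b) - φ n (b - a) + φ N (b - a) := by
    simp only [map_sub]; ring
  rw [h3]
  have := norm_add_le ((φ n b - φ N b) - φ n (b - a)) (φ N (b - a))
  have := norm_sub_le (φ n b - φ N b) (φ n (b - a))
  linarith [h1 n, h1 N]

/-- If a bounded sequence of functionals converges on the monomials to a functional, then it
converges to it pointwise. -/
theorem tendsto_of_monomial {φ : ℕ → ToeplitzAlgebra E →L[ℂ] ℂ} {ψ : ToeplitzAlgebra E →L[ℂ] ℂ}
    (hφ : ∀ n, ‖φ n‖ ≤ 1)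
    (h : ∀ x, Tendsto (fun n => φ n (monomial E x)) atTop (𝓝 (ψ (monomial E x))))
    (a : ToeplitzAlgebra E) : Tendsto (fun n => φ n a) atTop (𝓝 (ψ a)) := by
  have hc := cauchySeq_of_monomial hφ fun x => (h x).cauchySeq
  choose f hf using fun a => cauchySeq_tendsto_of_complete (hc a)
  -- By Banach-Steinhaus the pointwise limit is continuous, so agreement with ψ on monomials
  -- suffices.
  let θ := continuousLinearMapOfTendsto (σ₁₂ := RingHom.id ℂ) φ (tendsto_pi_nhds.mpr hf)
  have hθ : θ = ψ := clm_ext_monomial fun x => tendsto_nhds_unique (hf _) (h x)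
  have : f a = ψ a := DFunLike.congr_fun hθ a
  rw [← this]
  exact hf a

end FiniteVertices

end ToeplitzAlgebra

end DirectedGraph

/-! ### Twisted traces: vanishing off the diagonal and determination by the vertex values. -/

namespace DirectedGraph

namespace ToeplitzAlgebra

open ComplexConjugate

variable {V Ed : Type u} [Fintype Ed] {E : DirectedGraph V Ed}

/-- A hermitian functional `φ` with `φ(s_e b) = c φ(b s_e)` and `φ(p_v b) = φ(b p_v)` for all
`b`. -/
structure IsTwistedTrace (c : ℝ) (φ : ToeplitzAlgebra E →L[ℂ] ℂ) : Prop where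
  map_s_mul : ∀ e b, φ (s E e * b) = c * φ (b * s E e)
  map_p_mul : ∀ v b, φ (p E v * b) = φ (b * p E v)
  map_star : ∀ a, φ (star a) = conj (φ a)

namespace IsTwistedTrace

variable {c : ℝ} {φ : ToeplitzAlgebra E →L[ℂ] ℂ}

theorem map_word_mul (h : IsTwistedTrace c φ) (l : List Ed) (w : V) (b : ToeplitzAlgebra E) :
    φ (word E l w * b) = c ^ l.length * φ (b * word E l w) := by
  induction l generalizing b with
  | nil => rw [word_nil, h.map_p_mul, List.length_nil, pow_zero, one_mul]
  | cons e l ih =>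
    rw [word_cons, mul_assoc, h.map_s_mul, mul_assoc, ih, List.length_cons, pow_succ', mul_assoc,
      mul_assoc]

theorem map_mul_star_word (h : IsTwistedTrace c φ) (l : List Ed) (w : V) (b : ToeplitzAlgebra E) :
    φ (b * star (word E l w)) = c ^ l.length * φ (star (word E l w) * b) := by
  have h1 : b * star (word E l w) = star (word E l w * star b) := by simp
  have h2 : star (word E l w) * b = star (star b * word E l w) := by simp
  rw [h1, h2, h.map_star, h.map_star, h.map_word_mul, map_mul, map_pow, Complex.conj_ofReal]

/-- This is the recursion step: moving s_e cyclically meets s_e^* and produces p_{s(e)}, at the cost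
of a factor c and with both words one edge shorter. -/
theorem map_word_cons_mul_star_word_cons (h : IsTwistedTrace c φ) (e : Ed) (l : List Ed) (w : V)
    (l' : List Ed) (w' : V) :
    φ (word E (e :: l) w * star (word E (e :: l') w')) =
      c * φ (p E (E.s e) * word E l w * star (word E l' w')) := by
  rw [word_cons, word_cons, star_mul, mul_assoc, h.map_s_mul]
  congr 1
  rw [mul_assoc, mul_assoc, star_s_mul_self, ← mul_assoc, ← h.map_p_mul, mul_assoc]

theorem map_word_cons_mul_star_word_cons_of_ne (h : IsTwistedTrace c φ) {e f : Ed} (hef : e ≠ f)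
    (l : List Ed) (w : V) (l' : List Ed) (w' : V) :
    φ (word E (e :: l) w * star (word E (f :: l') w')) = 0 := by
  rw [word_cons, word_cons, star_mul, mul_assoc, h.map_s_mul, mul_assoc, mul_assoc,
    star_s_mul_s_of_ne E hef, mul_zero, mul_zero, map_zero, mul_zero]

variable [Fintype V]

/-- The relation with b = 1 gives φ(μ) = c^{|μ|} φ(μ), and c^{|μ|} ≠ 1. -/
theorem map_word_eq_zero (h : IsTwistedTrace c φ) (hc0 : 0 ≤ c) (hc1 : c < 1) {l : List Ed}
    (hl : l ≠ []) (w : V) : φ (word E l w) = 0 := by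
  have h1 := h.map_word_mul l w (unit E)
  rw [mul_unit, unit_mul] at h1
  have hpow : c ^ l.length < 1 := pow_lt_one₀ hc0 hc1 (by simpa using hl)
  have h2 : (1 - (c : ℂ) ^ l.length) * φ (word E l w) = 0 := by
    linear_combination h1
  rcases mul_eq_zero.mp h2 with h3 | h3
  · exfalso
    have : (c ^ l.length : ℝ) = 1 := by
      apply Complex.ofReal_injective
      push_cast
      linear_combination -h3
    exact hpow.ne this
  · exact h3

theorem map_monomial_eq_zero (h : IsTwistedTrace c φ) (hc0 : 0 ≤ c) (hc1 : c < 1) (l : List Ed)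
    (w : V) (l' : List Ed) (w' : V) (hl : l.length ≠ l'.length) :
    φ (word E l w * star (word E l' w')) = 0 := by
  induction l generalizing w l' w' with
  | nil =>
    have h1 : word E [] w * star (word E l' w') = star (word E l' w' * p E w) := by
      rw [star_mul, star_p, word_nil]
    have hl' : l' ≠ [] := by rintro rfl; exact hl rfl
    rw [h1, h.map_star]
    by_cases hw : w' = w
    · subst hw
      rw [word_mul_p, h.map_word_eq_zero hc0 hc1 hl', map_zero]
    · rw [word_mul_p_of_ne E _ hw, map_zero, map_zero]
  | cons e l ih =>
    cases l' with
    | nil =>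
      by_cases hw : w = w'
      · subst hw
        rw [word_nil, star_p, word_mul_p, h.map_word_eq_zero hc0 hc1 (by simp)]
      · rw [word_nil, star_p, word_mul_p_of_ne E _ hw, map_zero]
    | cons f l' =>
      by_cases hef : e = f
      · subst hef
        rw [h.map_word_cons_mul_star_word_cons]
        rcases p_mul_word E (E.s e) l w with h2 | h2
        · rw [h2, ih _ _ _ (by simpa using hl), mul_zero]
        · rw [h2, zero_mul, map_zero, mul_zero]
      · exact h.map_word_cons_mul_star_word_cons_of_ne hef _ _ _ _

/-- Twisted traces depend continuously on the parameter and on their values at the vertices. -/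
theorem tendsto_monomial {c' : ℕ → ℝ} {φ' : ℕ → ToeplitzAlgebra E →L[ℂ] ℂ}
    (h : IsTwistedTrace c φ) (h' : ∀ n, IsTwistedTrace (c' n) (φ' n))
    (hc0 : 0 ≤ c) (hc1 : c < 1) (hc0' : ∀ n, 0 ≤ c' n) (hc1' : ∀ n, c' n < 1)
    (hc : Tendsto c' atTop (𝓝 c))
    (hp : ∀ v, Tendsto (fun n => φ' n (p E v)) atTop (𝓝 (φ (p E v))))
    (x : (List Ed × V) × (List Ed × V)) :
    Tendsto (fun n => φ' n (monomial E x)) atTop (𝓝 (φ (monomial E x))) := by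
  obtain ⟨⟨l, w⟩, l', w'⟩ := x
  simp only [monomial]
  -- Both sides obey the same recursion on leading edges, which ends at a vertex projection or at 0.
  -- For constant sequences this is a uniqueness statement.
  induction l generalizing w l' w' with
  | nil =>
    cases l' with
    | nil =>
      simp only [word_nil, star_p]
      by_cases hw : w = w'
      · subst hw; simpa only [p_mul_self] using hp w
      · simp only [p_mul_p_of_ne E hw, map_zero, tendsto_const_nhds_iff]
    | cons f l' =>
      simp only [h.map_monomial_eq_zero hc0 hc1 [] w (f :: l') w' (by simp),
        fun n => (h' n).map_monomial_eq_zero (hc0' n) (hc1' n) [] w (f :: l') w' (by simp),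
        tendsto_const_nhds_iff]
  | cons e l ih =>
    cases l' with
    | nil =>
      simp only [h.map_monomial_eq_zero hc0 hc1 (e :: l) w [] w' (by simp),
        fun n => (h' n).map_monomial_eq_zero (hc0' n) (hc1' n) (e :: l) w [] w' (by simp),
        tendsto_const_nhds_iff]
    | cons f l' =>
      by_cases hef : e = f
      · subst hef
        simp only [h.map_word_cons_mul_star_word_cons,
          fun n => (h' n).map_word_cons_mul_star_word_cons]
        refine ((Complex.continuous_ofReal.tendsto c).comp hc).mul ?_
        rcases p_mul_word E (E.s e) l w with h2 | h2
        · simp only [h2]; exact ih _ _ _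
        · simp only [h2, zero_mul, map_zero, tendsto_const_nhds_iff]
      · simp only [h.map_word_cons_mul_star_word_cons_of_ne hef,
          fun n => (h' n).map_word_cons_mul_star_word_cons_of_ne hef, tendsto_const_nhds_iff]

end IsTwistedTrace

/-- Positive functionals are hermitian. -/
theorem map_star_of_nonneg [Fintype V] {φ : ToeplitzAlgebra E →L[ℂ] ℂ}
    (hφ : ∀ a, 0 ≤ φ (star a * a)) (a : ToeplitzAlgebra E) : φ (star a) = conj (φ a) := by
  -- Expand φ((1 + b)^*(1 + b)) ≥ 0. Taking b = a and b = ia then gives the imaginary and the real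
  -- part of the claim.
  have key : ∀ b : ToeplitzAlgebra E, (φ b + φ (star b)).im = 0 := by
    intro b
    have h1 : star (unit E + b) * (unit E + b) = star (unit E) * unit E + (b + star b) +
        star b * b := by
      rw [star_add, add_mul, mul_add, mul_add, mul_unit, star_unit, unit_mul b, mul_unit (star b)]
      abel
    have h2 := (Complex.nonneg_iff.mp (hφ (unit E + b))).2
    have h3 := (Complex.nonneg_iff.mp (hφ (unit E))).2
    have h4 := (Complex.nonneg_iff.mp (hφ b)).2
    rw [h1, map_add, map_add, map_add, Complex.add_im, Complex.add_im, ← h3, ← h4] at h2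
    linarith
  have h1 := key a
  have h2 := key (Complex.I • a)
  rw [star_smul, map_smul, map_smul, smul_eq_mul, smul_eq_mul, Complex.star_def,
    Complex.conj_I] at h2
  simp only [Complex.add_im, Complex.mul_im, Complex.neg_re, Complex.neg_im, Complex.I_re,
    Complex.I_im] at h1 h2
  refine Complex.ext ?_ ?_
  · rw [Complex.conj_re]; linarith
  · rw [Complex.conj_im]; linarith

/-! ### Equivalence of the KMS condition with the twisted trace relations. -/

section Dynamics

variable (E)

theorem dynamics_p (t : ℝ) (v : V) : dynamics E t (p E v) = p E v := gauge_p E _ v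

theorem dynamics_s (t : ℝ) (e : Ed) :
    dynamics E t (s E e) = Complex.exp (t * Complex.I) • s E e := by
  rw [dynamics, gauge_s, Circle.coe_exp]

theorem dynamics_word (t : ℝ) (l : List Ed) (w : V) :
    dynamics E t (word E l w) = Complex.exp (t * (Complex.I * l.length)) • word E l w := by
  induction l with
  | nil => simp [word_nil, dynamics_p]
  | cons e l ih =>
    rw [word_cons, map_mul, ih, dynamics_s, smul_mul_smul_comm, ← Complex.exp_add]
    congr 2
    push_cast [List.length_cons]
    ring

theorem dynamics_monomial (t : ℝ) (x : (List Ed × V) × (List Ed × V)) :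
    dynamics E t (monomial E x) =
      Complex.exp (t * (Complex.I * (x.1.1.length - x.2.1.length))) • monomial E x := by
  rw [monomial, map_mul, map_star, dynamics_word, dynamics_word, star_smul, smul_mul_smul_comm,
    Complex.star_def, ← Complex.exp_conj, ← Complex.exp_add]
  congr 2
  simp
  ring

theorem isEntireExtension_of_eigenvector {a : ToeplitzAlgebra E} {d : ℂ}
    (ha : ∀ t : ℝ, dynamics E t a = Complex.exp (t * (Complex.I * d)) • a) :
    IsEntireExtension (dynamics E) a fun z => Complex.exp (z * (Complex.I * d)) • a :=
  ⟨by fun_prop, fun t => (ha t).symm⟩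

theorem dynamics_zero (a : ToeplitzAlgebra E) : dynamics E 0 a = a := by
  have h : dynamics E 0 a = lift (rotatedFamily E (Circle.exp 0)) a := rfl
  rw [h, Circle.exp_zero, lift_rotated_one]
  rfl

theorem dynamics_add (t u : ℝ) (a : ToeplitzAlgebra E) :
    dynamics E (t + u) a = dynamics E t (dynamics E u a) := by
  have h : dynamics E (t + u) a = lift (rotatedFamily E (Circle.exp (t + u))) a := rfl
  rw [h, Circle.exp_add, ← lift_rotated_comp]
  rfl

end Dynamics

variable [Fintype V] {β : ℝ} {φ : ToeplitzAlgebra E →L[ℂ] ℂ}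

/-- If α_t(a) = e^{itd} a then α_{iβ}(a) = e^{-βd} a; here d = 1 for s_e and d = 0 for p_v. The KMS
condition applies to monomials b, which are analytic, and density extends it to all b. -/
theorem isTwistedTrace_of_isKMSState (hφ : IsKMSState (dynamics E) β φ) :
    IsTwistedTrace (Real.exp (-β)) φ := by
  have key : ∀ (a : ToeplitzAlgebra E) (d : ℂ),
      (∀ t : ℝ, dynamics E t a = Complex.exp (t * (Complex.I * d)) • a) →
      ∀ b, φ (a * b) = Complex.exp (-β * d) * φ (b * a) := by
    intro a d ha b
    have h : φ.comp (ContinuousLinearMap.mul ℂ _ a) =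
        Complex.exp (-β * d) • φ.comp ((ContinuousLinearMap.mul ℂ _).flip a) := by
      refine clm_ext_monomial fun x => ?_
      have h1 := hφ.2 a (monomial E x) _ _ (isEntireExtension_of_eigenvector E ha)
        (isEntireExtension_of_eigenvector E fun t => dynamics_monomial E t x)
      simp only [mul_smul_comm, map_smul] at h1
      have h2 : Complex.I * β * (Complex.I * d) = -β * d := by
        linear_combination (β * d : ℂ) * Complex.I_mul_I
      rw [h2] at h1
      exact h1
    exact DFunLike.congr_fun h b
  refine ⟨fun e b => ?_, fun v b => ?_, map_star_of_nonneg hφ.1.1⟩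
  · have := key (s E e) 1 (fun t => by rw [dynamics_s, mul_one]) b
    rw [this]
    push_cast
    rw [mul_one]
  · have := key (p E v) 0 (fun t => by simp [dynamics_p]) b
    rw [this]
    simp

/-- The dynamics fixes monomials with |μ| = |ν|, and φ vanishes on the others. -/
theorem IsTwistedTrace.map_dynamics (h : IsTwistedTrace (Real.exp (-β)) φ) (hβ : 0 < β) (t : ℝ)
    (a : ToeplitzAlgebra E) : φ (dynamics E t a) = φ a := by
  let α : ToeplitzAlgebra E →L[ℂ] ToeplitzAlgebra E :=
    ⟨(lift (rotatedFamily E (Circle.exp t)) : ToeplitzAlgebra E →ₗ[ℂ] ToeplitzAlgebra E),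
      NonUnitalStarAlgHom.instContinuousLinearMapClassComplex.map_continuous
        (lift (rotatedFamily E (Circle.exp t)))⟩
  have hα : φ.comp α = φ := by
    refine clm_ext_monomial fun x => ?_
    change φ (dynamics E t (monomial E x)) = _
    rw [dynamics_monomial, map_smul]
    by_cases hx : x.1.1.length = x.2.1.length
    · simp [hx]
    · rw [monomial, h.map_monomial_eq_zero (Real.exp_nonneg _) (by simpa using hβ) _ _ _ _ hx,
        smul_zero]
  exact DFunLike.congr_fun hα a

/-- Only b is reduced to a monomial; a stays an arbitrary analytic element. The twisted trace
relation and analytic continuation of z ↦ φ(b f(z)) to iβ both lead to the factor e^{βd}, where d =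
|μ| - |ν|. -/
theorem isKMSState_of_isTwistedTrace (hβ : 0 < β) (hφ : IsState φ)
    (h : IsTwistedTrace (Real.exp (-β)) φ) : IsKMSState (dynamics E) β φ := by
  refine ⟨hφ, fun a b f _ hf _ => ?_⟩
  have key : φ.comp (ContinuousLinearMap.mul ℂ _ a) =
      φ.comp ((ContinuousLinearMap.mul ℂ _).flip (f (Complex.I * β))) := by
    refine clm_ext_monomial fun x => ?_
    change φ (a * monomial E x) = φ (monomial E x * f (Complex.I * β))
    set d : ℂ := x.1.1.length - x.2.1.length with hd
    have h1 : φ (a * monomial E x) = Complex.exp (β * d) * φ (monomial E x * a) := by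
      have hexp : ((Real.exp (-β) : ℝ) : ℂ) ^ x.2.1.length =
          Complex.exp (β * d) * ((Real.exp (-β) : ℝ) : ℂ) ^ x.1.1.length := by
        rw [Complex.ofReal_exp, ← Complex.exp_nat_mul, ← Complex.exp_nat_mul, ← Complex.exp_add,
          hd]
        congr 1
        push_cast
        ring
      rw [monomial, ← mul_assoc, h.map_mul_star_word, mul_assoc, h.map_word_mul, ← mul_assoc,
        ← mul_assoc, hexp, mul_assoc]
    have h2 : (fun z => φ (monomial E x * f z)) =
        fun z => Complex.exp (-(z * (Complex.I * d))) * φ (monomial E x * a) := by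
      have hd1 : Differentiable ℂ fun z => φ (monomial E x * f z) := by
        have := hf.1
        exact (φ.comp (ContinuousLinearMap.mul ℂ _ (monomial E x))).differentiable.comp this
      have hd2 : Differentiable ℂ fun z : ℂ =>
          Complex.exp (-(z * (Complex.I * d))) * φ (monomial E x * a) := by fun_prop
      -- Two entire functions that agree on the real line coincide, since the nonzero reals
      -- accumulate at 0.
      refine AnalyticOnNhd.eq_of_frequently_eq (z₀ := 0)
        (fun z _ => hd1.analyticAt z) (fun z _ => hd2.analyticAt z) ?_
      have hreal : ∀ t : ℝ, φ (monomial E x * f t) =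
          Complex.exp (-(t * (Complex.I * d))) * φ (monomial E x * a) := by
        intro t
        -- By invariance φ(x α_t(a)) = φ(α_{-t}(x) a), and x is an eigenvector.
        have h3 : dynamics E t (dynamics E (-t) (monomial E x)) = monomial E x := by
          rw [← dynamics_add, add_neg_cancel, dynamics_zero]
        rw [hf.2 t]
        conv_lhs => rw [← h3]
        rw [← map_mul, h.map_dynamics hβ, dynamics_monomial, smul_mul_assoc, map_smul, smul_eq_mul]
        push_cast
        rw [neg_mul]
      have ht : Tendsto (fun t : ℝ => (t : ℂ)) (𝓝[≠] 0) (𝓝[≠] 0) := by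
        refine tendsto_nhdsWithin_of_tendsto_nhds_of_eventually_within _ ?_ ?_
        · exact (Complex.continuous_ofReal.tendsto' 0 0 Complex.ofReal_zero).mono_left
            nhdsWithin_le_nhds
        · filter_upwards [self_mem_nhdsWithin] with t ht
          simpa using ht
      exact ht.frequently (Frequently.of_forall hreal)
    have h3 := congrFun h2 (Complex.I * β)
    rw [h1, h3]
    congr 2
    linear_combination (β * d : ℂ) * Complex.I_mul_I
  exact DFunLike.congr_fun key b

end ToeplitzAlgebra

end DirectedGraph

/-! ### Partial isometries of ℓ² induced by partial bijections. -/

namespace PEquiv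

variable {X : Type*} (τ : X ≃. X)

/-- Composition of a function with a partial bijection, extended by zero. -/
def compZero (f : X → ℂ) (x : X) : ℂ := (τ x).elim 0 f

theorem compZero_of_some {f : X → ℂ} {x y : X} (h : τ x = some y) : compZero τ f x = f y := by
  rw [compZero, h]; rfl

theorem compZero_of_none {f : X → ℂ} {x : X} (h : τ x = none) : compZero τ f x = 0 := by
  rw [compZero, h]; rfl

/-- Since τ is injective where defined, the nonzero terms are values of f at distinct points. -/
theorem sum_norm_compZero_le (f : lp (fun _ : X => ℂ) 2) (T : Finset X) :
    ∑ x ∈ T, ‖compZero τ f x‖ ^ (2 : ℝ≥0∞).toReal ≤ ‖f‖ ^ (2 : ℝ≥0∞).toReal := by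
  classical
  have h1 : ∑ x ∈ T, ‖compZero τ f x‖ ^ (2 : ℝ≥0∞).toReal =
      ∑ x ∈ T.filter (fun x => (τ x).isSome), ‖compZero τ f x‖ ^ (2 : ℝ≥0∞).toReal := by
    refine (Finset.sum_filter_of_ne fun x _ hx => ?_).symm
    by_contra hn
    exact hx (by rw [compZero_of_none τ (by simpa using hn)]; simp)
  have h2 : ∑ x ∈ T.filter (fun x => (τ x).isSome), ‖compZero τ f x‖ ^ (2 : ℝ≥0∞).toReal =
      ∑ y ∈ (T.filter (fun x => (τ x).isSome)).filterMap τ (fun _ _ _ => τ.inj),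
        ‖f y‖ ^ (2 : ℝ≥0∞).toReal := by
    refine Finset.sum_bij (fun x hx => (τ x).get (Finset.mem_filter.mp hx).2) ?_ ?_ ?_ ?_
    · intro x hx
      rw [Finset.mem_filterMap]
      exact ⟨x, hx, by simp⟩
    · intro x hx y hy hxy
      exact τ.inj (b := (τ x).get (Finset.mem_filter.mp hx).2) (by simp) (by rw [hxy]; simp)
    · intro y hy
      obtain ⟨x, hx, hxy⟩ := Finset.mem_filterMap _ |>.mp hy
      exact ⟨x, hx, by simp [hxy]⟩
    · intro x hx
      rw [compZero_of_some τ (Option.some_get (Finset.mem_filter.mp hx).2).symm]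
  rw [h1, h2]
  exact lp.sum_rpow_le_norm_rpow (by norm_num) f _

/-- The partial isometry of `ℓ²(X)` given by composition with a partial bijection. -/
def toOp : lp (fun _ : X => ℂ) 2 →L[ℂ] lp (fun _ : X => ℂ) 2 :=
  LinearMap.mkContinuous
    { toFun := fun f => ⟨compZero τ f, memℓp_gen' (sum_norm_compZero_le τ f)⟩
      map_add' := fun f g => lp.ext <| funext fun x => by
        change compZero τ (f + g) x = compZero τ f x + compZero τ g x
        cases h : τ x with
        | none => simp [compZero_of_none τ h]
        | some y => simp [compZero_of_some τ h]
      map_smul' := fun c f => lp.ext <| funext fun x => by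
        change compZero τ (c • f) x = c • compZero τ f x
        cases h : τ x with
        | none => simp [compZero_of_none τ h]
        | some y => simp [compZero_of_some τ h] }
    1 fun f => by
      rw [one_mul]
      exact lp.norm_le_of_forall_sum_le (by norm_num) (norm_nonneg f) (sum_norm_compZero_le τ f)

theorem toOp_apply (f : lp (fun _ : X => ℂ) 2) (x : X) : toOp τ f x = compZero τ f x := rfl

theorem toOp_single [DecidableEq X] (y : X) (c : ℂ) :
    toOp τ (lp.single 2 y c) = (τ.symm y).elim 0 fun x => lp.single 2 x c := by
  refine lp.ext <| funext fun z => ?_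
  rw [toOp_apply]
  cases h : τ z with
  | none =>
    rw [compZero_of_none _ h]
    cases h' : τ.symm y with
    | none => rfl
    | some x =>
      have hx := τ.eq_some_iff.mp h'
      have hne : z ≠ x := by rintro rfl; rw [h] at hx; cases hx
      exact (lp.single_apply_ne (E := fun _ : X => ℂ) 2 x c hne).symm
  | some w =>
    rw [compZero_of_some _ h]
    have h1 := τ.eq_some_iff.mpr h
    by_cases hw : w = y
    · subst hw
      rw [h1]
      exact (lp.single_apply_self (E := fun _ : X => ℂ) 2 w c).trans
        (lp.single_apply_self (E := fun _ : X => ℂ) 2 z c).symm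
    · refine (lp.single_apply_ne (E := fun _ : X => ℂ) 2 y c hw).trans ?_
      cases h' : τ.symm y with
      | none => rfl
      | some x =>
        have hx := τ.eq_some_iff.mp h'
        have hne : z ≠ x := by
          rintro rfl
          rw [h] at hx
          exact hw (Option.some.inj hx)
        exact (lp.single_apply_ne (E := fun _ : X => ℂ) 2 x c hne).symm

theorem adjoint_toOp : ContinuousLinearMap.adjoint (toOp τ) = toOp τ.symm := by
  classical
  refine ContinuousLinearMap.ext fun f => lp.ext <| funext fun x => ?_
  have h1 : ∀ g : lp (fun _ : X => ℂ) 2, g x = inner ℂ (lp.single 2 x (1 : ℂ)) g := fun g => by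
    rw [lp.inner_single_left]; simp
  rw [h1, ContinuousLinearMap.adjoint_inner_right, toOp_single, toOp_apply]
  cases h : τ.symm x with
  | none => rw [compZero_of_none _ h]; exact inner_zero_left _
  | some y =>
    rw [compZero_of_some _ h]
    change inner ℂ (lp.single 2 y (1 : ℂ)) f = _
    rw [lp.inner_single_left]
    simp

end PEquiv

/-! ### The Fock representation and its vacuum functionals. -/

namespace DirectedGraph

variable {V Ed : Type u} (E : DirectedGraph V Ed)

/-- The range of a list of edges, followed by the vertex `w`. -/
def listRange : List Ed × V → V
  | ([], w) => w
  | (e :: _, _) => E.r e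

open Classical in
/-- Removal of a leading edge `e` from a list of edges. -/
def removeEdge (e : Ed) : List Ed × V → Option (List Ed × V)
  | ([], _) => none
  | (f :: l, w) => if f = e ∧ E.listRange (l, w) = E.s e then some (l, w) else none

open Classical in
/-- The partial bijection which removes a leading edge `e`. -/
def edgePEquiv (e : Ed) : (List Ed × V) ≃. (List Ed × V) where
  toFun := E.removeEdge e
  invFun x := if E.listRange x = E.s e then some (e :: x.1, x.2) else none
  inv := by
    rintro ⟨l, w⟩ ⟨l', w'⟩
    cases l with
    | nil => simp [removeEdge]
    | cons f l =>
      simp only [removeEdge, Option.ite_none_right_eq_some, Option.some.injEq,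
        Prod.mk.injEq, List.cons.injEq]
      constructor
      · rintro ⟨h1, ⟨rfl, rfl⟩, rfl⟩
        exact ⟨⟨rfl, h1⟩, rfl, rfl⟩
      · rintro ⟨⟨rfl, h1⟩, rfl, rfl⟩
        exact ⟨h1, ⟨rfl, rfl⟩, rfl⟩

open Classical in
/-- The partial identity on the lists with range `v`. -/
def vertexPEquiv (v : V) : (List Ed × V) ≃. (List Ed × V) :=
  PEquiv.ofSet {x | E.listRange x = v}

/-- The Hilbert space `ℓ²(X)`, where `X` is the set of pairs of a list of edges and a vertex. -/
abbrev FockSpace (V Ed : Type u) : Type u := lp (fun _ : List Ed × V => ℂ) 2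

/-- The projection onto the lists with range `v`. -/
def vertexOp (v : V) : FockSpace V Ed →L[ℂ] FockSpace V Ed := PEquiv.toOp (E.vertexPEquiv v)

/-- The creation operator of the edge `e`. -/
def edgeOp (e : Ed) : FockSpace V Ed →L[ℂ] FockSpace V Ed := PEquiv.toOp (E.edgePEquiv e)

open Classical in
theorem vertexOp_apply (v : V) (f : FockSpace V Ed) (x : List Ed × V) :
    E.vertexOp v f x = if E.listRange x = v then f x else 0 := by
  rw [vertexOp, PEquiv.toOp_apply, PEquiv.compZero]
  change Option.elim (if E.listRange x = v then some x else none) 0 f = _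
  split_ifs <;> rfl

theorem edgeOp_apply_nil (e : Ed) (f : FockSpace V Ed) (w : V) :
    E.edgeOp e f ([], w) = 0 := rfl

open Classical in
theorem edgeOp_apply_cons (e g : Ed) (l : List Ed) (f : FockSpace V Ed) (w : V) :
    E.edgeOp e f (g :: l, w) = if g = e ∧ E.listRange (l, w) = E.s e then f (l, w) else 0 := by
  rw [edgeOp, PEquiv.toOp_apply, PEquiv.compZero]
  change Option.elim (if g = e ∧ E.listRange (l, w) = E.s e then some (l, w) else none) 0 f = _
  split_ifs <;> rfl

open Classical in
theorem star_edgeOp_apply (e : Ed) (f : FockSpace V Ed) (x : List Ed × V) :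
    star (E.edgeOp e) f x = if E.listRange x = E.s e then f (e :: x.1, x.2) else 0 := by
  rw [edgeOp, ContinuousLinearMap.star_eq_adjoint, PEquiv.adjoint_toOp, PEquiv.toOp_apply,
    PEquiv.compZero]
  change Option.elim (if E.listRange x = E.s e then some (e :: x.1, x.2) else none) 0 f = _
  split_ifs <;> rfl

theorem star_vertexOp (v : V) : star (E.vertexOp v) = E.vertexOp v := by
  rw [vertexOp, ContinuousLinearMap.star_eq_adjoint, PEquiv.adjoint_toOp, vertexPEquiv,
    PEquiv.ofSet_symm]

theorem star_edgeOp_mul_edgeOp (e : Ed) :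
    star (E.edgeOp e) * E.edgeOp e = E.vertexOp (E.s e) := by
  classical
  refine ContinuousLinearMap.ext fun f => lp.ext <| funext fun x => ?_
  rw [mul_apply_eq_comp, star_edgeOp_apply, vertexOp_apply, edgeOp_apply_cons]
  split_ifs <;> simp_all

theorem vertexOp_mul_vertexOp (v w : V) [Decidable (v = w)] :
    E.vertexOp v * E.vertexOp w = if v = w then E.vertexOp v else 0 := by
  classical
  refine ContinuousLinearMap.ext fun f => lp.ext <| funext fun x => ?_
  rw [mul_apply_eq_comp, vertexOp_apply, vertexOp_apply]
  by_cases h : v = w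
  · subst h
    rw [if_pos rfl, vertexOp_apply]
    split_ifs <;> rfl
  · rw [if_neg h]
    have : ¬(E.listRange x = v ∧ E.listRange x = w) := fun hx => h (hx.1.symm.trans hx.2)
    by_cases h1 : E.listRange x = v
    · rw [if_pos h1, if_neg fun h2 => this ⟨h1, h2⟩]; rfl
    · rw [if_neg h1]; rfl

theorem edgeOp_mul_vertexOp (e : Ed) : E.edgeOp e * E.vertexOp (E.s e) = E.edgeOp e := by
  classical
  refine ContinuousLinearMap.ext fun f => lp.ext <| funext fun x => ?_
  rw [mul_apply_eq_comp]
  obtain ⟨l, w⟩ := x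
  cases l with
  | nil => rfl
  | cons g l =>
    rw [edgeOp_apply_cons, edgeOp_apply_cons, vertexOp_apply]
    split_ifs <;> simp_all

open Classical in
theorem edgeOp_mul_star_apply_cons (e g : Ed) (l : List Ed) (f : FockSpace V Ed) (w : V) :
    (E.edgeOp e * star (E.edgeOp e)) f (g :: l, w) =
      if g = e ∧ E.listRange (l, w) = E.s e then f (g :: l, w) else 0 := by
  rw [mul_apply_eq_comp, edgeOp_apply_cons, star_edgeOp_apply]
  split_ifs with h h'
  · rw [h.1]
  · exact absurd h.2 h'
  · rfl

open Classical in
/-- The vector at the empty list of edges and the vertex `v`. -/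
def vacuumVector (v : V) : FockSpace V Ed := lp.single 2 ([], v) 1

theorem norm_vacuumVector (v : V) : ‖(vacuumVector v : FockSpace V Ed)‖ = 1 := by
  classical
  rw [vacuumVector, lp.norm_single (by norm_num)]
  simp

theorem inner_vacuumVector (v : V) (f : FockSpace V Ed) :
    inner ℂ (vacuumVector v) f = f ([], v) := by
  classical
  rw [vacuumVector, lp.inner_single_left]
  simp

variable [Fintype Ed]

theorem fock_rangeSum_apply (v : V) (f : FockSpace V Ed) (x : List Ed × V) :
    E.rangeSum E.edgeOp v f x = ∑ e, open Classical in
      if E.r e = v then (E.edgeOp e * star (E.edgeOp e)) f x else 0 := by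
  classical
  rw [rangeSum, ← Finset.sum_filter]
  rw [sum_apply, lp.coeFn_sum, Finset.sum_apply]

open Classical in
theorem fock_rangeSum_apply_cons (v : V) (f : FockSpace V Ed) (g : Ed) (l : List Ed) (w : V) :
    E.rangeSum E.edgeOp v f (g :: l, w) =
      if E.r g = v ∧ E.listRange (l, w) = E.s g then f (g :: l, w) else 0 := by
  rw [fock_rangeSum_apply, Finset.sum_eq_single_of_mem g (Finset.mem_univ g)]
  · rw [edgeOp_mul_star_apply_cons]
    split_ifs <;> simp_all
  · intro e _ he
    rw [edgeOp_mul_star_apply_cons, if_neg fun h : g = e ∧ _ => he h.1.symm, ite_self]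

theorem fock_rangeSum_apply_nil (v : V) (f : FockSpace V Ed) (w : V) :
    E.rangeSum E.edgeOp v f ([], w) = 0 := by
  rw [fock_rangeSum_apply]
  refine Finset.sum_eq_zero fun e _ => ?_
  split_ifs <;> rfl

theorem fock_gap_apply (v : V) : ∃ D : Set (List Ed × V), ∀ (f : FockSpace V Ed) x,
    (E.vertexOp v - E.rangeSum E.edgeOp v) f x = open Classical in if x ∈ D then f x else 0 := by
  classical
  -- The gap is the coordinate projection onto the lists with range v from which no leading edge can
  -- be removed: the empty one, and those that fail to compose at the first edge, as arbitrary lists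
  -- are admitted.
  refine ⟨{x | E.listRange x = v ∧ ∀ g l, x.1 = g :: l → E.listRange (l, x.2) ≠ E.s g},
    fun f x => ?_⟩
  have h : (E.vertexOp v - E.rangeSum E.edgeOp v) f x =
    E.vertexOp v f x - E.rangeSum E.edgeOp v f x := rfl
  rw [h, vertexOp_apply]
  obtain ⟨l, w⟩ := x
  cases l with
  | nil =>
    rw [fock_rangeSum_apply_nil, sub_zero]
    simp
  | cons g l =>
    rw [fock_rangeSum_apply_cons]
    have h1 : E.listRange (g :: l, w) = E.r g := rfl
    rw [h1]
    by_cases h2 : E.r g = v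
    · by_cases h3 : E.listRange (l, w) = E.s g
      · rw [if_pos h2, if_pos ⟨h2, h3⟩, sub_self, if_neg]
        exact fun h => h.2 g l rfl h3
      · rw [if_pos h2, if_neg fun h => h3 h.2, sub_zero, if_pos]
        refine ⟨h2, fun g' l' h => ?_⟩
        obtain ⟨rfl, rfl⟩ := List.cons.inj h
        exact h3
    · rw [if_neg h2, if_neg fun h => h2 h.1, sub_zero, if_neg]
      exact fun h => h2 h.1

/-- The Toeplitz-Cuntz-Krieger family on the Fock space. -/
def fockFamily : TCKFamily E (FockSpace V Ed →L[ℂ] FockSpace V Ed) where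
  P := E.vertexOp
  S := E.edgeOp
  isStarProjection v := by
    classical
    exact ⟨(E.vertexOp_mul_vertexOp v v).trans (if_pos rfl), E.star_vertexOp v⟩
  orthogonal v w h := by
    classical
    rw [vertexOp_mul_vertexOp, if_neg h]
  partialIsometry e := by rw [mul_assoc, star_edgeOp_mul_edgeOp, edgeOp_mul_vertexOp]
  star_mul_self := E.star_edgeOp_mul_edgeOp
  gap_nonneg v := by
    classical
    refine ⟨E.vertexOp v - E.rangeSum E.edgeOp v, ?_⟩
    have h1 : star (E.vertexOp v - E.rangeSum E.edgeOp v) =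
        E.vertexOp v - E.rangeSum E.edgeOp v := by
      rw [star_sub, star_vertexOp]
      simp [rangeSum]
    rw [h1]
    obtain ⟨D, hD⟩ := E.fock_gap_apply v
    refine ContinuousLinearMap.ext fun f => lp.ext <| funext fun x => ?_
    rw [mul_apply_eq_comp, hD, hD, hD]
    split_ifs <;> rfl

namespace ToeplitzAlgebra

/-- The vector functional of `vacuumVector v` in the Fock representation. -/
def vacuum (v : V) : ToeplitzAlgebra E →L[ℂ] ℂ :=
  LinearMap.mkContinuous
    { toFun := fun a => inner ℂ (vacuumVector v) (lift E.fockFamily a (vacuumVector v))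
      map_add' := fun a b => by rw [map_add, add_apply, inner_add_right]
      map_smul' := fun c a => by
        rw [map_smul, smul_apply, inner_smul_right]; rfl }
    1 fun a => by
      refine (norm_inner_le_norm (𝕜 := ℂ) (vacuumVector v)
        (lift E.fockFamily a (vacuumVector v))).trans ?_
      refine (mul_le_mul_of_nonneg_left (ContinuousLinearMap.le_opNorm _ _)
        (norm_nonneg _)).trans ?_
      rw [norm_vacuumVector, one_mul, one_mul, mul_one]
      exact NonUnitalStarAlgHom.norm_apply_le _ _

theorem vacuum_apply (v : V) (a : ToeplitzAlgebra E) :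
    vacuum E v a = lift E.fockFamily a (vacuumVector v) ([], v) := inner_vacuumVector _ _

theorem norm_vacuum_le (v : V) : ‖vacuum E v‖ ≤ 1 :=
  LinearMap.mkContinuous_norm_le _ zero_le_one _

theorem vacuum_nonneg (v : V) (a : ToeplitzAlgebra E) : 0 ≤ vacuum E v (star a * a) := by
  change 0 ≤ inner ℂ (vacuumVector v) (lift E.fockFamily (star a * a) (vacuumVector v))
  rw [map_mul, map_star, ContinuousLinearMap.star_eq_adjoint, mul_apply_eq_comp,
    ContinuousLinearMap.adjoint_inner_right, inner_self_eq_norm_sq_to_K]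
  rw [← RCLike.ofReal_pow]
  exact Complex.zero_le_real.mpr (sq_nonneg _)

/-- Creation operators never reach an empty list. -/
theorem vacuum_s_mul (v : V) (e : Ed) (a : ToeplitzAlgebra E) : vacuum E v (s E e * a) = 0 := by
  rw [vacuum_apply, map_mul, lift_s]
  exact E.edgeOp_apply_nil e _ v

theorem vacuum_p_mul (v : V) (a : ToeplitzAlgebra E) : vacuum E v (p E v * a) = vacuum E v a := by
  classical
  rw [vacuum_apply, vacuum_apply, map_mul, lift_p]
  exact (E.vertexOp_apply v _ _).trans (if_pos rfl)

theorem vacuum_p_mul_of_ne {v w : V} (h : v ≠ w) (a : ToeplitzAlgebra E) :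
    vacuum E v (p E w * a) = 0 := by
  classical
  rw [vacuum_apply, map_mul, lift_p]
  exact (E.vertexOp_apply w _ _).trans (if_neg h)

theorem vacuum_p (v : V) : vacuum E v (p E v) = 1 := by
  classical
  rw [vacuum_apply, lift_p]
  refine (E.vertexOp_apply v _ _).trans ((if_pos rfl).trans ?_)
  exact lp.single_apply_self (E := fun _ : List Ed × V => ℂ) 2 ([], v) 1

end ToeplitzAlgebra

end DirectedGraph

/-! ### Construction of a state from a subinvariant vector by truncated path sums. -/

namespace DirectedGraph

open ComplexConjugate

variable {V Ed : Type u} [Fintype Ed] (E : DirectedGraph V Ed)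

open Classical in
/-- The sum of `m (s e)` over the edges `e` with range `v`, which is the entry `(A m) v`. -/
def edgeSum (m : V → ℝ) (v : V) : ℝ := ∑ e ∈ Finset.univ.filter (fun e => E.r e = v), m (E.s e)

theorem vertexMatrix_mulVec [Fintype V] (m : V → ℝ) (v : V) :
    ((E.vertexMatrix.map (Nat.cast : ℕ → ℝ)).mulVec m) v = E.edgeSum m v := by
  classical
  rw [edgeSum, ← Finset.sum_fiberwise _ E.s, Matrix.mulVec, dotProduct]
  refine Finset.sum_congr rfl fun w _ => ?_
  rw [Finset.sum_congr rfl (g := fun _ => m w)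
    (fun e he => by rw [(Finset.mem_filter.mp he).2]), Finset.sum_const, nsmul_eq_mul]
  congr 2
  rw [Matrix.map_apply, vertexMatrix, Nat.card_eq_fintype_card, Fintype.card_subtype,
    Finset.filter_filter]

namespace ToeplitzAlgebra

/-- The map `a ↦ s_e^* a s_e`. -/
def compress (e : Ed) : ToeplitzAlgebra E →L[ℂ] ToeplitzAlgebra E :=
  (ContinuousLinearMap.mul ℂ _ (star (s E e))).comp ((ContinuousLinearMap.mul ℂ _).flip (s E e))

theorem compress_apply (e : Ed) (a : ToeplitzAlgebra E) :
    compress E e a = star (s E e) * (a * s E e) := rfl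

theorem norm_compress_le (e : Ed) : ‖compress E e‖ ≤ 1 := by
  refine ContinuousLinearMap.opNorm_le_bound _ zero_le_one fun a => ?_
  rw [compress_apply]
  refine (norm_mul_le _ _).trans ?_
  rw [norm_star]
  refine mul_le_mul (norm_s_le E e) ?_ (norm_nonneg _) zero_le_one
  exact (norm_mul_le _ _).trans (mul_le_of_le_one_right (norm_nonneg _) (norm_s_le E e))

variable (c : ℝ) (m : V → ℝ)

open Classical in
/-- The sum of the vector functionals of the lists with range `v` and length at most `N`, where
a path `μ` of length less than `N` has the weight `c ^ |μ| (m - c A m) (s μ)`, and a path of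
length `N` has the weight `c ^ N m (s μ)`. -/
def pathFunctional : ℕ → V → ToeplitzAlgebra E →L[ℂ] ℂ
  | 0, v => (m v : ℂ) • vacuum E v
  | N + 1, v => ((m v - c * E.edgeSum m v : ℝ) : ℂ) • vacuum E v + (c : ℂ) •
      ∑ e ∈ Finset.univ.filter (fun e => E.r e = v),
        (pathFunctional N (E.s e)).comp (compress E e)

open Classical in
theorem pathFunctional_succ_apply (N : ℕ) (v : V) (a : ToeplitzAlgebra E) :
    pathFunctional E c m (N + 1) v a = ((m v - c * E.edgeSum m v : ℝ) : ℂ) * vacuum E v a +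
      c * ∑ e ∈ Finset.univ.filter (fun e => E.r e = v),
        pathFunctional E c m N (E.s e) (star (s E e) * (a * s E e)) := by
  simp only [pathFunctional, add_apply, smul_apply, sum_apply, smul_eq_mul,
    ContinuousLinearMap.comp_apply, compress_apply]

theorem pathFunctional_zero_apply (v : V) (a : ToeplitzAlgebra E) :
    pathFunctional E c m 0 v a = m v * vacuum E v a := rfl

theorem pathFunctional_p_mul (N : ℕ) (v : V) (a : ToeplitzAlgebra E) :
    pathFunctional E c m N v (p E v * a) = pathFunctional E c m N v a := by
  classical
  cases N with
  | zero => rw [pathFunctional_zero_apply, pathFunctional_zero_apply, vacuum_p_mul]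
  | succ N =>
    rw [pathFunctional_succ_apply, pathFunctional_succ_apply, vacuum_p_mul]
    congr 2
    refine Finset.sum_congr rfl fun e he => ?_
    obtain rfl := (Finset.mem_filter.mp he).2
    rw [mul_assoc, ← mul_assoc, star_s_mul_p]

theorem pathFunctional_p_mul_of_ne (N : ℕ) {v w : V} (h : v ≠ w) (a : ToeplitzAlgebra E) :
    pathFunctional E c m N v (p E w * a) = 0 := by
  classical
  cases N with
  | zero => rw [pathFunctional_zero_apply, vacuum_p_mul_of_ne E h, mul_zero]
  | succ N =>
    rw [pathFunctional_succ_apply, vacuum_p_mul_of_ne E h, mul_zero, zero_add]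
    rw [Finset.sum_eq_zero, mul_zero]
    intro e he
    obtain rfl := (Finset.mem_filter.mp he).2
    rw [mul_assoc, ← mul_assoc, star_s_mul_p_of_ne E h.symm, zero_mul, map_zero]

/-- The weights telescope, (m - cAm)(v) + c (Am)(v) = m(v), so the truncation loses no mass for any
N. -/
theorem pathFunctional_p (N : ℕ) (v : V) : pathFunctional E c m N v (p E v) = m v := by
  classical
  induction N generalizing v with
  | zero => rw [pathFunctional_zero_apply, vacuum_p, mul_one]
  | succ N ih =>
    rw [pathFunctional_succ_apply, vacuum_p, mul_one,
      Finset.sum_congr rfl (g := fun e => (m (E.s e) : ℂ)), edgeSum]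
    · push_cast
      ring
    · intro e he
      obtain rfl := (Finset.mem_filter.mp he).2
      rw [p_mul_s, star_s_mul_self, ih]

variable {E c m}

/-- Subinvariance is exactly the nonnegativity of the weight m - cAm. -/
theorem pathFunctional_nonneg (hc : 0 ≤ c) (hm : ∀ v, 0 ≤ m v)
    (hsub : ∀ v, c * E.edgeSum m v ≤ m v) (N : ℕ) (v : V) (a : ToeplitzAlgebra E) :
    0 ≤ pathFunctional E c m N v (star a * a) := by
  classical
  induction N generalizing v a with
  | zero =>
    rw [pathFunctional_zero_apply]
    exact mul_nonneg (Complex.zero_le_real.mpr (hm v)) (vacuum_nonneg E v a)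
  | succ N ih =>
    rw [pathFunctional_succ_apply]
    refine add_nonneg (mul_nonneg (Complex.zero_le_real.mpr (sub_nonneg.mpr (hsub v)))
      (vacuum_nonneg E v a)) (mul_nonneg (Complex.zero_le_real.mpr hc)
      (Finset.sum_nonneg fun e _ => ?_))
    have h : star (s E e) * (star a * a * s E e) = star (a * s E e) * (a * s E e) := by
      simp only [star_mul, mul_assoc]
    rw [h]
    exact ih _ _

theorem norm_pathFunctional_le (hc : 0 ≤ c) (hm : ∀ v, 0 ≤ m v)
    (hsub : ∀ v, c * E.edgeSum m v ≤ m v) (N : ℕ) (v : V) :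
    ‖pathFunctional E c m N v‖ ≤ m v := by
  classical
  induction N generalizing v with
  | zero =>
    rw [pathFunctional, norm_smul, Complex.norm_real, Real.norm_of_nonneg (hm v)]
    exact mul_le_of_le_one_right (hm v) (norm_vacuum_le E v)
  | succ N ih =>
    rw [pathFunctional]
    refine (norm_add_le _ _).trans ?_
    rw [norm_smul, norm_smul, Complex.norm_real, Complex.norm_real, Real.norm_of_nonneg hc,
      Real.norm_of_nonneg (sub_nonneg.mpr (hsub v))]
    have h1 := mul_le_of_le_one_right (sub_nonneg.mpr (hsub v)) (norm_vacuum_le E v)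
    have h2 : ‖∑ e ∈ Finset.univ.filter (fun e => E.r e = v),
        (pathFunctional E c m N (E.s e)).comp (compress E e)‖ ≤ E.edgeSum m v := by
      refine norm_sum_le_of_le _ fun e _ => ?_
      refine (ContinuousLinearMap.opNorm_comp_le _ _).trans ?_
      exact (mul_le_of_le_one_right (norm_nonneg _) (norm_compress_le E e)).trans (ih _)
    have h3 := mul_le_mul_of_nonneg_left h2 hc
    linarith

variable [Fintype V]

variable (E c m) in
/-- The sum of the functionals `pathFunctional` over all vertices. -/
def approxState (N : ℕ) : ToeplitzAlgebra E →L[ℂ] ℂ := ∑ v, pathFunctional E c m N v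

theorem approxState_apply (N : ℕ) (a : ToeplitzAlgebra E) :
    approxState E c m N a = ∑ v, pathFunctional E c m N v a := by
  rw [approxState, sum_apply]

theorem approxState_p_mul (N : ℕ) (v : V) (a : ToeplitzAlgebra E) :
    approxState E c m N (p E v * a) = pathFunctional E c m N v a := by
  rw [approxState_apply, Finset.sum_eq_single_of_mem v (Finset.mem_univ v), pathFunctional_p_mul]
  exact fun w _ hw => pathFunctional_p_mul_of_ne E c m N hw a

theorem approxState_p (N : ℕ) (v : V) : approxState E c m N (p E v) = m v := by
  rw [← p_mul_self, approxState_p_mul, pathFunctional_p]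

theorem approxState_zero_s_mul (e : Ed) (a : ToeplitzAlgebra E) :
    approxState E c m 0 (s E e * a) = 0 := by
  rw [approxState_apply]
  exact Finset.sum_eq_zero fun v _ => by
    rw [pathFunctional_zero_apply, vacuum_s_mul, mul_zero]

section

variable (hc : 0 ≤ c) (hm : ∀ v, 0 ≤ m v) (hsub : ∀ v, c * E.edgeSum m v ≤ m v)

include hc hm hsub

theorem approxState_nonneg (N : ℕ) (a : ToeplitzAlgebra E) :
    0 ≤ approxState E c m N (star a * a) := by
  rw [approxState_apply]
  exact Finset.sum_nonneg fun v _ => pathFunctional_nonneg hc hm hsub N v a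

theorem norm_approxState_le (N : ℕ) : ‖approxState E c m N‖ ≤ ∑ v, m v :=
  norm_sum_le_of_le _ fun v _ => norm_pathFunctional_le hc hm hsub N v

theorem approxState_star (N : ℕ) (a : ToeplitzAlgebra E) :
    approxState E c m N (star a) = conj (approxState E c m N a) :=
  map_star_of_nonneg (approxState_nonneg hc hm hsub N) a

theorem approxState_mul_p (N : ℕ) (v : V) (a : ToeplitzAlgebra E) :
    approxState E c m N (p E v * a) = approxState E c m N (a * p E v) := by
  have h : a * p E v = star (p E v * star a) := by rw [star_mul, star_star, star_p]
  rw [h, approxState_star hc hm hsub, approxState_p_mul, approxState_p_mul,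
    map_star_of_nonneg (pathFunctional_nonneg hc hm hsub N v), Complex.conj_conj]

/-- In the recursion for N + 1 the vacuum term dies and only the summand of e survives, which is the
functional for N. The shift in N disappears in the limit and leaves the twisted trace relation. -/
theorem approxState_succ_s_mul (N : ℕ) (e : Ed) (a : ToeplitzAlgebra E) :
    approxState E c m (N + 1) (s E e * a) = c * approxState E c m N (a * s E e) := by
  classical
  have h1 : approxState E c m N (a * s E e) = pathFunctional E c m N (E.s e) (a * s E e) := by
    rw [← approxState_p_mul, approxState_mul_p hc hm hsub, mul_assoc, s_mul_p]
  rw [h1, approxState_apply,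
    Finset.sum_eq_single_of_mem (E.r e) (Finset.mem_univ _)]
  · rw [pathFunctional_succ_apply, vacuum_s_mul, mul_zero, zero_add,
      Finset.sum_eq_single_of_mem e (by simp)]
    · rw [mul_assoc, ← mul_assoc, star_s_mul_self, pathFunctional_p_mul]
    · intro f _ hf
      rw [mul_assoc, ← mul_assoc, star_s_mul_s_of_ne E hf.symm, zero_mul, map_zero]
  · intro v _ hv
    rw [← p_mul_s, mul_assoc, pathFunctional_p_mul_of_ne E c m _ hv]

/-- A cyclic move lowers N and keeps the word nonempty, or gives 0; at N = 0 the vacuum functionals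
vanish on it. -/
theorem approxState_word_eq_zero (N : ℕ) (e : Ed) (l : List Ed) (w : V) :
    approxState E c m N (word E (e :: l) w) = 0 := by
  induction N generalizing e l w with
  | zero => rw [word_cons, approxState_zero_s_mul]
  | succ N ih =>
    rw [word_cons, approxState_succ_s_mul hc hm hsub]
    by_cases hw : w = E.r e
    · subst hw
      rw [← word_append_singleton]
      cases l with
      | nil => rw [List.nil_append, ih, mul_zero]
      | cons f l => rw [List.cons_append, ih, mul_zero]
    · rw [word_mul_s_of_ne E _ hw, map_zero, mul_zero]

/-- Each cancelled pair of leading edges uses up one unit of N; after finitely many steps a value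
independent of N remains. -/
theorem approxState_monomial_eventually_const (l : List Ed) (w : V) (l' : List Ed) (w' : V) :
    ∃ K z, ∀ N, K ≤ N → approxState E c m N (word E l w * star (word E l' w')) = z := by
  induction l generalizing w l' w' with
  | nil =>
    have h1 : word E [] w * star (word E l' w') = star (word E l' w' * p E w) := by
      rw [star_mul, star_p, word_nil]
    by_cases hw : w' = w
    · subst hw
      rw [h1, word_mul_p]
      cases l' with
      | nil => exact ⟨0, m w', fun N _ => by rw [word_nil, star_p, approxState_p]⟩
      | cons f l' =>
        exact ⟨0, 0, fun N _ => by
          rw [approxState_star hc hm hsub, approxState_word_eq_zero hc hm hsub, map_zero]⟩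
    · exact ⟨0, 0, fun N _ => by rw [h1, word_mul_p_of_ne E _ hw, star_zero, map_zero]⟩
  | cons e l ih =>
    cases l' with
    | nil =>
      refine ⟨0, 0, fun N _ => ?_⟩
      by_cases hw : w = w'
      · subst hw
        rw [word_nil, star_p, word_mul_p, approxState_word_eq_zero hc hm hsub]
      · rw [word_nil, star_p, word_mul_p_of_ne E _ hw, map_zero]
    | cons f l' =>
      have h1 : ∀ N, approxState E c m (N + 1) (word E (e :: l) w * star (word E (f :: l') w')) =
          c * approxState E c m N (word E l w * star (word E l' w') * (star (s E f) * s E e)) := by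
        intro N
        rw [word_cons, word_cons, star_mul, mul_assoc, approxState_succ_s_mul hc hm hsub]
        simp only [mul_assoc]
      by_cases hef : e = f
      · subst hef
        rcases p_mul_word E (E.s e) l w with h2 | h2
        · obtain ⟨K, z, hK⟩ := ih w l' w'
          refine ⟨K + 1, c * z, fun N hN => ?_⟩
          obtain ⟨N, rfl⟩ : ∃ n, N = n + 1 := ⟨N - 1, by omega⟩
          rw [h1, star_s_mul_self, ← approxState_mul_p hc hm hsub, ← mul_assoc, h2,
            hK N (by omega)]
        · refine ⟨1, 0, fun N hN => ?_⟩
          obtain ⟨N, rfl⟩ : ∃ n, N = n + 1 := ⟨N - 1, by omega⟩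
          rw [h1, star_s_mul_self, ← approxState_mul_p hc hm hsub, ← mul_assoc, h2, zero_mul,
            map_zero, mul_zero]
      · refine ⟨1, 0, fun N hN => ?_⟩
        obtain ⟨N, rfl⟩ : ∃ n, N = n + 1 := ⟨N - 1, by omega⟩
        rw [h1, star_s_mul_s_of_ne E hef, mul_zero, map_zero, mul_zero]

theorem exists_state_of_subinvariant (hsum : ∑ v, m v = 1) :
    ∃ φ : ToeplitzAlgebra E →L[ℂ] ℂ, IsState φ ∧ IsTwistedTrace c φ ∧ ∀ v, φ (p E v) = m v := by
  have hnorm : ∀ N, ‖approxState E c m N‖ ≤ 1 := fun N =>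
    (norm_approxState_le hc hm hsub N).trans hsum.le
  have hcauchy := cauchySeq_of_monomial hnorm fun x => by
    obtain ⟨K, z, hK⟩ := approxState_monomial_eventually_const hc hm hsub x.1.1 x.1.2 x.2.1 x.2.2
    exact (tendsto_atTop_of_eventually_const hK).cauchySeq
  choose f hf using fun a => cauchySeq_tendsto_of_complete (hcauchy a)
  let φ : ToeplitzAlgebra E →L[ℂ] ℂ := continuousLinearMapOfTendsto (σ₁₂ := RingHom.id ℂ)
    (approxState E c m) (tendsto_pi_nhds.mpr hf)
  have hφ : ∀ a, Tendsto (fun N => approxState E c m N a) atTop (𝓝 (φ a)) := hf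
  have hp : ∀ v, φ (p E v) = m v := fun v =>
    tendsto_nhds_unique (hφ _) (by simp only [approxState_p]; exact tendsto_const_nhds)
  refine ⟨φ, ⟨fun a => ?_, le_antisymm ?_ ?_⟩, ⟨fun e b => ?_, fun v b => ?_, fun a => ?_⟩, hp⟩
  · exact ge_of_tendsto' (hφ _) fun N => approxState_nonneg hc hm hsub N a
  · refine ContinuousLinearMap.opNorm_le_bound _ zero_le_one fun a => ?_
    exact le_of_tendsto' (hφ a).norm fun N => (approxState E c m N).le_of_opNorm_le (hnorm N) a
  -- The norm is attained at the identity, where the value is ∑ m_v = 1.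
  · have h1 : φ (unit E) = 1 := by
      rw [unit, map_sum]
      simp only [hp]
      exact_mod_cast hsum
    have h2 := φ.le_opNorm (unit E)
    rw [h1, norm_one] at h2
    exact h2.trans (mul_le_of_le_one_right (norm_nonneg _) (norm_unit_le E))
  · refine tendsto_nhds_unique ((tendsto_add_atTop_iff_nat 1).mpr (hφ (s E e * b))) ?_
    simp only [approxState_succ_s_mul hc hm hsub]
    exact (hφ _).const_mul _
  · refine tendsto_nhds_unique (hφ _) ?_
    simp only [approxState_mul_p hc hm hsub]
    exact hφ _
  · refine tendsto_nhds_unique (hφ _) ?_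
    simp only [approxState_star hc hm hsub]
    exact (Complex.continuous_conj.tendsto _).comp (hφ a)

end

/-- A state takes the value `1` at the identity. -/
theorem map_unit_of_isState {φ : ToeplitzAlgebra E →L[ℂ] ℂ} (hφ : IsState φ) :
    φ (unit E) = 1 := by
  have hpos := Complex.nonneg_iff.mp (hφ.1 (unit E))
  rw [star_unit, unit_mul_unit] at hpos
  have hle : ‖φ (unit E)‖ ≤ 1 := by
    have := φ.le_opNorm (unit E)
    rw [hφ.2, one_mul] at this
    exact this.trans (norm_unit_le E)
  -- Expand φ((1 - a)^*(1 - a)) ≥ 0. Rotating a so that φ(a) ≥ 0 turns this into 1 = ‖φ‖ ≤ (φ(1) +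
  -- 1)/2.
  have key : ∀ a : ToeplitzAlgebra E, ‖a‖ ≤ 1 → 2 * (φ a).re ≤ (φ (unit E)).re + 1 := by
    intro a ha
    have h1 : star (unit E - a) * (unit E - a) = unit E - a - star a + star a * a := by
      rw [star_sub, sub_mul, mul_sub, mul_sub, star_unit, unit_mul_unit, unit_mul, mul_unit]
      abel
    have h2 := (Complex.nonneg_iff.mp (hφ.1 (unit E - a))).1
    rw [h1, map_add, map_sub, map_sub, map_star_of_nonneg hφ.1, Complex.add_re, Complex.sub_re,
      Complex.sub_re, Complex.conj_re] at h2
    have h3 : (φ (star a * a)).re ≤ 1 := by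
      refine (Complex.re_le_norm _).trans ((φ.le_opNorm _).trans ?_)
      rw [hφ.2, one_mul, CStarRing.norm_star_mul_self]
      exact mul_le_one₀ ha (norm_nonneg _) ha
    linarith
  have hnorm : ‖φ‖ ≤ ((φ (unit E)).re + 1) / 2 := by
    refine ContinuousLinearMap.opNorm_le_of_unit_norm (by linarith [hpos.1]) fun a ha => ?_
    have h1 : ‖(conj (φ a) / ‖φ a‖ : ℂ) • a‖ ≤ 1 := by
      rw [norm_smul, ha, mul_one, norm_div, RCLike.norm_conj, Complex.norm_real, norm_norm]
      exact div_self_le_one _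
    have h2 : φ ((conj (φ a) / ‖φ a‖ : ℂ) • a) = (‖φ a‖ : ℂ) := by
      rw [map_smul, smul_eq_mul, div_mul_eq_mul_div, mul_comm, Complex.mul_conj,
        Complex.normSq_eq_norm_sq, sq, Complex.ofReal_mul, mul_self_div_self]
    have h3 := key _ h1
    rw [h2, Complex.ofReal_re] at h3
    linarith
  rw [hφ.2] at hnorm
  have hre : (φ (unit E)).re = 1 :=
    le_antisymm ((Complex.re_le_norm _).trans hle) (by linarith)
  exact Complex.ext hre hpos.2.symm

end ToeplitzAlgebra

end DirectedGraph

/-! ### The bijection between KMS states and subinvariant vectors, and convergence of KMS states. -/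

namespace DirectedGraph

variable {V Ed : Type u} [Fintype Ed] [Fintype V] {E : DirectedGraph V Ed}

theorem mul_edgeSum_le_iff (β : ℝ) (m : V → ℝ) (v : V) :
    Real.exp (-β) * E.edgeSum m v ≤ m v ↔
      ((E.vertexMatrix.map (Nat.cast : ℕ → ℝ)).mulVec m) v ≤ Real.exp β * m v := by
  rw [vertexMatrix_mulVec, Real.exp_neg, inv_mul_le_iff₀ (Real.exp_pos β)]

theorem exists_mem_kmsStates {β : ℝ} (hβ : 0 < β) {m : V → ℝ}
    (hm : m ∈ E.subinvariantUnitVectors β) :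
    ∃ φ ∈ E.kmsStates β, ∀ v, φ (ToeplitzAlgebra.p E v) = m v := by
  obtain ⟨h0, h1, h2⟩ := hm
  simp only [fun v => abs_of_nonneg (h0 v)] at h1
  obtain ⟨φ, hφ, hφ', hp⟩ := ToeplitzAlgebra.exists_state_of_subinvariant (E := E)
    (Real.exp_nonneg (-β)) h0 (fun v => (mul_edgeSum_le_iff β m v).mpr (h2 v)) h1
  exact ⟨φ, ToeplitzAlgebra.isKMSState_of_isTwistedTrace hβ hφ hφ', hp⟩

theorem exists_mem_subinvariantUnitVectors {β : ℝ} {φ : ToeplitzAlgebra E →L[ℂ] ℂ}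
    (hφ : φ ∈ E.kmsStates β) :
    ∃ m ∈ E.subinvariantUnitVectors β, ∀ v, (m v : ℂ) = φ (ToeplitzAlgebra.p E v) := by
  classical
  have hs : IsState φ := hφ.1
  have ht := ToeplitzAlgebra.isTwistedTrace_of_isKMSState hφ
  have hp : ∀ v, 0 ≤ φ (ToeplitzAlgebra.p E v) := fun v => by
    have := hs.1 (ToeplitzAlgebra.p E v)
    rwa [ToeplitzAlgebra.star_p, ToeplitzAlgebra.p_mul_self] at this
  have hre : ∀ v, ((φ (ToeplitzAlgebra.p E v)).re : ℂ) = φ (ToeplitzAlgebra.p E v) := fun v =>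
    Complex.ext rfl (Complex.nonneg_iff.mp (hp v)).2
  have hnn : ∀ v, 0 ≤ (φ (ToeplitzAlgebra.p E v)).re := fun v => (Complex.nonneg_iff.mp (hp v)).1
  refine ⟨fun v => (φ (ToeplitzAlgebra.p E v)).re, ⟨hnn, ?_, fun v => ?_⟩, hre⟩
  · simp only [abs_of_nonneg (hnn _)]
    have h := ToeplitzAlgebra.map_unit_of_isState hs
    rw [ToeplitzAlgebra.unit, map_sum] at h
    rw [← Complex.re_sum, h, Complex.one_re]
  · rw [← mul_edgeSum_le_iff]
    -- Subinvariance is positivity of φ on the gap, since φ(s_e s_e^*) = c φ(p_{s(e)}).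
    obtain ⟨b, hb⟩ := (ToeplitzAlgebra.univFamily E).gap_nonneg v
    have h1 := hs.1 b
    rw [← hb] at h1
    have h2 : φ (E.rangeSum (ToeplitzAlgebra.s E) v) = ((Real.exp (-β) *
        E.edgeSum (fun v => (φ (ToeplitzAlgebra.p E v)).re) v : ℝ) : ℂ) := by
      rw [rangeSum, edgeSum, map_sum, Complex.ofReal_mul, Complex.ofReal_sum, Finset.mul_sum]
      refine Finset.sum_congr rfl fun e _ => ?_
      rw [ht.map_s_mul, ToeplitzAlgebra.star_s_mul_self, hre]
    have h3 : 0 ≤ (φ (ToeplitzAlgebra.p E v) - φ (E.rangeSum (ToeplitzAlgebra.s E) v)).re := by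
      rw [← map_sub]
      exact (Complex.nonneg_iff.mp h1).1
    rw [h2, Complex.sub_re, Complex.ofReal_re] at h3
    exact sub_nonneg.mp h3

theorem bijOn_kmsStates {β : ℝ} (hβ : 0 < β) :
    Set.BijOn
      (fun (φ : E.ToeplitzAlgebra →L[ℂ] ℂ) (v : V) => φ (ToeplitzAlgebra.p E v))
      (E.kmsStates β)
      ((fun (m : V → ℝ) (v : V) => (m v : ℂ)) '' E.subinvariantUnitVectors β) := by
  refine ⟨fun φ hφ => ?_, fun φ hφ ψ hψ h => ?_, ?_⟩
  · obtain ⟨m, hm, h⟩ := exists_mem_subinvariantUnitVectors hφ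
    exact ⟨m, hm, funext h⟩
  · refine ToeplitzAlgebra.clm_ext_monomial fun x => ?_
    have h1 : Real.exp (-β) < 1 := by simpa using hβ
    -- Injectivity is the continuity statement for constant sequences.
    have h2 := (ToeplitzAlgebra.isTwistedTrace_of_isKMSState hψ).tendsto_monomial
      (φ' := fun _ => φ) (c' := fun _ => Real.exp (-β))
      (fun _ => ToeplitzAlgebra.isTwistedTrace_of_isKMSState hφ) (Real.exp_nonneg _) h1
      (fun _ => Real.exp_nonneg _) (fun _ => h1) tendsto_const_nhds
      (fun v => by rw [tendsto_const_nhds_iff]; exact congrFun h v) x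
    exact tendsto_const_nhds_iff.mp h2
  · rintro _ ⟨m, hm, rfl⟩
    obtain ⟨φ, hφ, h⟩ := exists_mem_kmsStates hβ hm
    exact ⟨φ, hφ, funext h⟩

theorem tendsto_of_mem_kmsStates {β : ℝ} {b : ℕ → ℝ} (hβ : 0 < β) (hb : ∀ n, 0 < b n)
    (hlim : Tendsto b atTop (𝓝 β)) {ψ : ℕ → E.ToeplitzAlgebra →L[ℂ] ℂ}
    {φ : E.ToeplitzAlgebra →L[ℂ] ℂ} (hψ : ∀ n, ψ n ∈ E.kmsStates (b n)) (hφ : φ ∈ E.kmsStates β)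
    (hp : ∀ v, Tendsto (fun n => ψ n (ToeplitzAlgebra.p E v)) atTop
      (𝓝 (φ (ToeplitzAlgebra.p E v)))) (a : E.ToeplitzAlgebra) :
    Tendsto (fun n => ψ n a) atTop (𝓝 (φ a)) := by
  refine ToeplitzAlgebra.tendsto_of_monomial (fun n => (hψ n).1.2.le) (fun x => ?_) a
  exact (ToeplitzAlgebra.isTwistedTrace_of_isKMSState hφ).tendsto_monomial
    (fun n => ToeplitzAlgebra.isTwistedTrace_of_isKMSState (hψ n)) (Real.exp_nonneg _)
    (by simpa using hβ) (fun _ => Real.exp_nonneg _) (fun n => by simpa using hb n)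
    ((Real.continuous_exp.tendsto _).comp hlim.neg) hp x

/-! ### Existence of subinvariant vectors from the spectral radius. -/

section SpectralRadius

attribute [local instance] Matrix.linftyOpNormedRing Matrix.linftyOpNormedAlgebra

/-- Gelfand's formula in the maximal row sum norm: some ‖A^n‖^{1/n} is below e^β, and ‖A^n‖ bounds
the entries of A^n 1. -/
theorem exists_pow_mulVec_one_le [DecidableEq V] {β : ℝ} (hβ : E.logSpectralRadius < (β : EReal)) :
    ∃ n : ℕ, 0 < n ∧ ∀ v, (((E.vertexMatrix.map (Nat.cast : ℕ → ℝ)) ^ n).mulVec 1) v ≤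
      Real.exp β ^ n := by
  have hρ : spectralRadius ℂ (E.vertexMatrix.map (Nat.cast : ℕ → ℂ)) <
      ENNReal.ofReal (Real.exp β) := by
    rw [← ENNReal.log_lt_log_iff]
    refine hβ.trans_le ?_
    rw [ENNReal.log_ofReal_of_pos (Real.exp_pos β), Real.log_exp]
  have hlim := spectrum.pow_nnnorm_pow_one_div_tendsto_nhds_spectralRadius
    (E.vertexMatrix.map (Nat.cast : ℕ → ℂ))
  obtain ⟨n, hn, hn0⟩ := ((hlim.eventually_lt_const hρ).and (eventually_gt_atTop 0)).exists
  refine ⟨n, hn0, fun v => ?_⟩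
  have hle : ‖(E.vertexMatrix.map (Nat.cast : ℕ → ℂ)) ^ n‖₊ ≤ Real.toNNReal (Real.exp β) ^ n := by
    have h1 := ENNReal.rpow_le_rpow hn.le (Nat.cast_nonneg n : (0 : ℝ) ≤ n)
    rw [← ENNReal.rpow_mul, one_div, inv_mul_cancel₀ (by positivity), ENNReal.rpow_one,
      ENNReal.rpow_natCast, ENNReal.ofReal] at h1
    exact_mod_cast h1
  have hmap : (E.vertexMatrix.map (Nat.cast : ℕ → ℂ)) ^ n =
      ((E.vertexMatrix.map (Nat.cast : ℕ → ℝ)) ^ n).map ((↑) : ℝ → ℂ) := by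
    have h1 : E.vertexMatrix.map (Nat.cast : ℕ → ℂ) =
        Complex.ofRealHom.mapMatrix (E.vertexMatrix.map (Nat.cast : ℕ → ℝ)) := by
      ext i j; simp
    rw [h1, ← map_pow]
    rfl
  have hrow : ∑ w, ‖((E.vertexMatrix.map (Nat.cast : ℕ → ℂ)) ^ n) v w‖₊ ≤
      ‖(E.vertexMatrix.map (Nat.cast : ℕ → ℂ)) ^ n‖₊ := by
    rw [Matrix.linfty_opNNNorm_def]
    exact Finset.le_sup (f := fun v => ∑ w, ‖((E.vertexMatrix.map (Nat.cast : ℕ → ℂ)) ^ n) v w‖₊)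
      (Finset.mem_univ v)
  have h2 : ((∑ w, ‖((E.vertexMatrix.map (Nat.cast : ℕ → ℂ)) ^ n) v w‖₊ : NNReal) : ℝ) ≤
      Real.exp β ^ n := by
    have := NNReal.coe_le_coe.mpr (hrow.trans hle)
    rwa [NNReal.coe_pow, Real.coe_toNNReal _ (Real.exp_nonneg β)] at this
  refine le_trans ?_ h2
  rw [NNReal.coe_sum, Matrix.mulVec, dotProduct]
  refine Finset.sum_le_sum fun w _ => ?_
  rw [hmap, Matrix.map_apply, coe_nnnorm, Complex.norm_real, Pi.one_apply, mul_one]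
  exact Real.le_norm_self _

end SpectralRadius

theorem subinvariantUnitVectors_nonempty [DecidableEq V] [Nonempty V] {β : ℝ}
    (hβ : E.logSpectralRadius < (β : EReal)) : (E.subinvariantUnitVectors β).Nonempty := by
  obtain ⟨n, hn0, hn⟩ := exists_pow_mulVec_one_le hβ
  set A := E.vertexMatrix.map (Nat.cast : ℕ → ℝ) with hA
  set c := Real.exp (-β) with hc
  have hc0 : 0 < c := Real.exp_pos _
  have hcβ : Real.exp β * c = 1 := by rw [hc, ← Real.exp_add, add_neg_cancel, Real.exp_zero]
  have hpow : ∀ k v, 0 ≤ ((A ^ k).mulVec 1) v := by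
    intro k
    induction k with
    | zero => intro v; simp
    | succ k ih =>
      intro v
      rw [pow_succ', ← Matrix.mulVec_mulVec]
      exact Finset.sum_nonneg fun w _ => mul_nonneg (Nat.cast_nonneg (E.vertexMatrix v w)) (ih w)
  -- A truncated Neumann series for (1 - cA)^{-1} 1. Telescoping gives cAx = x + c^n A^n 1 - 1 ≤ x
  -- by the choice of n, and the term k = 0 gives x ≥ 1.
  let x : V → ℝ := fun v => ∑ k ∈ Finset.range n, c ^ k * ((A ^ k).mulVec 1) v
  have hx1 : ∀ v, 1 ≤ x v := fun v => by
    have h := Finset.single_le_sum (f := fun k => c ^ k * ((A ^ k).mulVec 1) v)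
      (fun k _ => mul_nonneg (pow_nonneg hc0.le k) (hpow k v)) (Finset.mem_range.mpr hn0)
    simpa using h
  have hAx : ∀ v, (A.mulVec x) v ≤ Real.exp β * x v := by
    intro v
    have h1 : x = ∑ k ∈ Finset.range n, c ^ k • (A ^ k).mulVec 1 := by
      ext v; simp [x, Finset.sum_apply]
    have h2 : A.mulVec x =
        Real.exp β • ∑ k ∈ Finset.range n, c ^ (k + 1) • (A ^ (k + 1)).mulVec 1 := by
      rw [h1, Matrix.mulVec_sum, Finset.smul_sum]
      refine Finset.sum_congr rfl fun k _ => ?_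
      rw [Matrix.mulVec_smul, Matrix.mulVec_mulVec, ← pow_succ', smul_smul, pow_succ' c,
        ← mul_assoc, hcβ, one_mul]
    have h3 : (∑ k ∈ Finset.range n, c ^ (k + 1) • (A ^ (k + 1)).mulVec 1) v =
        x v + c ^ n * ((A ^ n).mulVec 1) v - 1 := by
      have h4 := Finset.sum_range_succ' (fun k => c ^ k * ((A ^ k).mulVec 1) v) n
      rw [Finset.sum_range_succ] at h4
      simp only [pow_zero, Matrix.one_mulVec, Pi.one_apply, mul_one] at h4
      simp only [Finset.sum_apply, Pi.smul_apply, smul_eq_mul, x]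
      linarith
    rw [h2, Pi.smul_apply, smul_eq_mul, h3]
    refine mul_le_mul_of_nonneg_left ?_ (Real.exp_nonneg β)
    have h5 := mul_le_mul_of_nonneg_left (hn v) (pow_nonneg hc0.le n)
    rw [← mul_pow, mul_comm c, hcβ, one_pow] at h5
    linarith
  have hS : 0 < ∑ v, x v :=
    Finset.sum_pos (fun v _ => zero_lt_one.trans_le (hx1 v)) Finset.univ_nonempty
  have hnn : ∀ v, 0 ≤ (∑ v, x v)⁻¹ * x v := fun v =>
    mul_nonneg (inv_nonneg.mpr hS.le) (zero_le_one.trans (hx1 v))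
  refine ⟨(∑ v, x v)⁻¹ • x, hnn, ?_, fun v => ?_⟩
  · simp only [Pi.smul_apply, smul_eq_mul, abs_of_nonneg (hnn _)]
    rw [← Finset.mul_sum, inv_mul_cancel₀ hS.ne']
  · rw [Matrix.mulVec_smul, Pi.smul_apply, Pi.smul_apply, smul_eq_mul, smul_eq_mul,
      mul_left_comm]
    exact mul_le_mul_of_nonneg_left (hAx v) (inv_nonneg.mpr hS.le)

/-- The unit vectors lie in a compact simplex, and the inequality Am ≤ e^β m passes to limits
jointly in m and β. -/
theorem subinvariantUnitVectors_nonempty_of_tendsto {β : ℝ} {b : ℕ → ℝ}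
    (hlim : Tendsto b atTop (𝓝 β)) (hb : ∀ n, (E.subinvariantUnitVectors (b n)).Nonempty) :
    (E.subinvariantUnitVectors β).Nonempty := by
  choose m hm using hb
  have hmem : ∀ n, m n ∈ stdSimplex ℝ V := fun n => by
    refine ⟨(hm n).1, ?_⟩
    have h := (hm n).2.1
    simpa only [fun v => abs_of_nonneg ((hm n).1 v)] using h
  obtain ⟨μ, hμ, g, hg, hconv⟩ := (isCompact_stdSimplex ℝ V).tendsto_subseq hmem
  have hv : ∀ v, Tendsto (fun n => m (g n) v) atTop (𝓝 (μ v)) := tendsto_pi_nhds.mp hconv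
  refine ⟨μ, hμ.1, ?_, fun v => ?_⟩
  · simp only [fun v => abs_of_nonneg (hμ.1 v)]
    exact hμ.2
  · refine le_of_tendsto_of_tendsto' (b := atTop) (f := fun n =>
      ((E.vertexMatrix.map (Nat.cast : ℕ → ℝ)).mulVec (m (g n))) v)
      (g := fun n => Real.exp (b (g n)) * m (g n) v) ?_ ?_ fun n => (hm (g n)).2.2 v
    · exact tendsto_finsetSum _ fun w _ => (hv w).const_mul _
    · exact ((Real.continuous_exp.tendsto _).comp (hlim.comp hg.tendsto_atTop)).mul (hv v)

theorem subinvariantUnitVectors_mono {β β' : ℝ} (h : β ≤ β') :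
    E.subinvariantUnitVectors β ⊆ E.subinvariantUnitVectors β' := fun _ hm =>
  ⟨hm.1, hm.2.1, fun v => (hm.2.2 v).trans
    (mul_le_mul_of_nonneg_right (Real.exp_le_exp.mpr h) (hm.1 v))⟩

end DirectedGraph

end

theorem corollary3 {V Ed : Type u} [Fintype V] [DecidableEq V] [Fintype Ed]
    (E : DirectedGraph V Ed) (β : ℝ) (hβ : 0 < β) (hρ : E.logSpectralRadius ≤ (β : EReal)) :
    Set.BijOn
      (fun (φ : E.ToeplitzAlgebra →L[ℂ] ℂ) (v : V) => φ (DirectedGraph.ToeplitzAlgebra.p E v))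
      (E.kmsStates β)
      ((fun (m : V → ℝ) (v : V) => (m v : ℂ)) '' E.subinvariantUnitVectors β) ∧
    (E.logSpectralRadius = (β : EReal) →
      ∀ b : ℕ → ℝ, StrictAnti b → Tendsto b atTop (𝓝 β) →
        ∃ (ψ : ℕ → (E.ToeplitzAlgebra →L[ℂ] ℂ)) (φ : E.ToeplitzAlgebra →L[ℂ] ℂ),
          (∀ n, ψ n ∈ E.kmsStates (b n)) ∧ φ ∈ E.kmsStates β ∧
          ∀ a, Tendsto (fun n => ψ n a) atTop (𝓝 (φ a))) := by
  refine ⟨DirectedGraph.bijOn_kmsStates hβ, fun hlog b hanti hlim => ?_⟩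
  -- The empty graph has ρ(A) = 0, hence ln ρ(A) = -∞, which is not the real number β.
  have hV : Nonempty V := by
    by_contra hV
    rw [not_nonempty_iff] at hV
    rw [DirectedGraph.logSpectralRadius, spectrum.SpectralRadius.of_subsingleton,
      ENNReal.log_zero] at hlog
    exact EReal.bot_ne_coe β hlog
  have hlt : ∀ n, β < b n := fun n =>
    (hanti.antitone.le_of_tendsto hlim (n + 1)).trans_lt (hanti n.lt_succ_self)
  obtain ⟨m, hm⟩ := DirectedGraph.subinvariantUnitVectors_nonempty_of_tendsto hlim fun n =>
    DirectedGraph.subinvariantUnitVectors_nonempty (E := E)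
      (hρ.trans_lt (EReal.coe_lt_coe_iff.mpr (hlt n)))
  obtain ⟨φ, hφ, hφm⟩ := DirectedGraph.exists_mem_kmsStates hβ hm
  -- The limit vector m itself is used at every β_n, so the vertex values are constant and only the
  -- parameter varies.
  choose ψ hψ hψm using fun n => DirectedGraph.exists_mem_kmsStates (hβ.trans (hlt n))
    (DirectedGraph.subinvariantUnitVectors_mono (hlt n).le hm)
  refine ⟨ψ, φ, hψ, hφ, fun a => ?_⟩
  refine DirectedGraph.tendsto_of_mem_kmsStates hβ (fun n => hβ.trans (hlt n)) hlim hψ hφ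
    (fun v => ?_) a
  simp only [hψm, hφm]
  exact tendsto_const_nhds
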